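/- Let $d\ge 1$ be an integer, $\beta\in(0,2)$ with $\beta\ne d$ (that is, $(d,\beta)\neq(1,1)$), and $\gamma>0$. For a function $u:\mathbb{R}^d\to\mathbb{R}$ let $$I_\beta(u)(x)=C_{d,\beta}\int_{\mathbb{R}^d}\frac{u(x+z)}{|z|^{d-\beta}}\,dz,\qquad C_{d,\beta}=\frac{\Gamma\left(\frac{d-\beta}{2}\right)}{\pi^{d/2}\,2^{\beta}\,\Gamma\left(\frac{\beta}{2}\right)},$$ be its Riesz potential, and let $\phi(y)=(1-|y|^2)_+^{\gamma/2}$. Then for every $y\in\mathbb{R}^d$ the integral defining $I_\beta(\phi)(y)$ converges absolutely, and $$I_\beta(\phi)(y)=\begin{cases} C_{\gamma,\beta,d}\;{}_2F_1\left(\frac{d-\beta}{2},-\frac{\gamma+\beta}{2};\frac d2;|y|^2\right) & \text{for } |y|\le 1,\\[1ex] \tilde C_{\gamma,\beta,d}\,|y|^{\beta-d}\;{}_2F_1\left(\frac{d-\beta}{2},\frac{2-\beta}{2};\frac{d+\gamma}{2}+1;\frac1{|y|^2}\right) & \text{for } |y|\ge 1,\end{cases}$$ where ${}_2F_1$ is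 the hypergeometric function (the sum of the Gauss hypergeometric series) and $$C_{\gamma,\beta,d}=2^{-\beta}\frac{\Gamma\left(\frac\gamma2+1\right)\Gamma\left(\frac{d-\beta}2\right)}{\Gamma\left(\frac d2\right)\Gamma\left(\frac{\beta+\gamma}2+1\right)},\qquad \tilde C_{\gamma,\beta,d}=2^{-\beta}\frac{\Gamma\left(\frac\gamma2+1\right)\Gamma\left(\frac{d-\beta}2\right)}{\Gamma\left(\frac \beta2\right)\Gamma\left(\frac{d+\gamma}2+1\right)}.$$ -/

import Mathlib

open MeasureTheory

noncomputable section

/-- The normalising constant `Γ((d-β)/2) / (π^(d/2) 2^β Γ(β/2))` of the Riesz potential on `ℝ^d`,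
the one for which the potential is the Fourier multiplier `|ξ|^(-β)` when `0 < β < d`. -/
def rieszConstant (d : ℕ) (β : ℝ) : ℝ :=
  Real.Gamma (((d : ℝ) - β) / 2) / (Real.pi ^ ((d : ℝ) / 2) * 2 ^ β * Real.Gamma (β / 2))

/-- The integrand `z ↦ u (x + z) / |z|^(d-β)` of the Riesz potential of `u` at `x`. -/
def rieszIntegrand {d : ℕ} (β : ℝ) (u : EuclideanSpace ℝ (Fin d) → ℝ)
    (x z : EuclideanSpace ℝ (Fin d)) : ℝ :=
  u (x + z) / ‖z‖ ^ ((d : ℝ) - β)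

/-- The Riesz potential `I_β u` on `ℝ^d`. -/
def rieszPotential {d : ℕ} (β : ℝ) (u : EuclideanSpace ℝ (Fin d) → ℝ)
    (x : EuclideanSpace ℝ (Fin d)) : ℝ :=
  rieszConstant d β * ∫ z, rieszIntegrand β u x z

/-- The profile `(1 - |y|²)_+^(γ/2)`. -/
def ballProfile {d : ℕ} (γ : ℝ) (y : EuclideanSpace ℝ (Fin d)) : ℝ :=
  max (1 - ‖y‖ ^ 2) 0 ^ (γ / 2)

/-- The constant in the formula inside the unit ball. -/
def innerConstant (d : ℕ) (γ β : ℝ) : ℝ :=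
  2 ^ (-β) * (Real.Gamma (γ / 2 + 1) * Real.Gamma (((d : ℝ) - β) / 2)) /
    (Real.Gamma ((d : ℝ) / 2) * Real.Gamma ((β + γ) / 2 + 1))

/-- The constant in the formula outside the unit ball. -/
def outerConstant (d : ℕ) (γ β : ℝ) : ℝ :=
  2 ^ (-β) * (Real.Gamma (γ / 2 + 1) * Real.Gamma (((d : ℝ) - β) / 2)) /
    (Real.Gamma (β / 2) * Real.Gamma (((d : ℝ) + γ) / 2 + 1))

end

open Set Filter Topology ProbabilityTheory
open scoped Nat

/-! Put `a = (d-β)/2`, `h = β/2`, `p = γ/2`, and suppose first `β < d`. The profile depends only on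
`|w|²`, so it suffices to know the law of `|w|²` under `|w-y|^(-2a) dw`. Writing the kernel as a
Gamma mixture of Gaussians gives the Laplace transform of this law: a constant times `t^(-h) ∫₀¹
x^(a-1) (1-x)^(h-1) e^(-t|y|²x) dx`. Since `t^(-h)` is the transform of `r^(h-1)/Γ(h)`, uniqueness
identifies the law with that of `r + |y|²x` under a product density
(`map_sq_norm_withDensity_rpow_eq`). Against `(1-u)_+^p`, the `r`-integral is a Beta integral
producing `(1-|y|²x)_+^(p+h)`; the remaining `x`-integral is Euler's integral for `₂F₁`, directly if
`|y| ≤ 1` and after rescaling if `|y| ≥ 1`.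

The only other case is `d = 1 < β < 2`, where `a < 0`. There the potential is, up to its constant,
the Mellin transform at `β` of a bounded compactly supported function. Both sides are holomorphic in
`β` and agree on `(0,1)`, hence on `(0,2)`. This needs `|y| ≠ 1`; continuity in `|y|`, with Raabe's
test for the series at `1`, gives the unit sphere. -/

/-! ### The Gauss series on `[0, 1]` and Euler's integral. -/

lemma ordinaryHypergeometricCoefficient_succ (a b c : ℝ) (n : ℕ) :
    ordinaryHypergeometricCoefficient a b c (n + 1) =
      ordinaryHypergeometricCoefficient a b c n * ((a + n) * (b + n) / ((c + n) * (n + 1))) := by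
  simp only [ordinaryHypergeometricCoefficient, Nat.factorial_succ, ascPochhammer_succ_eval,
    Nat.cast_mul, mul_inv_rev, Nat.cast_add, Nat.cast_one, div_eq_mul_inv]
  ring

/-- Raabe's test for the Gauss hypergeometric series at `1`. -/
lemma summable_ordinaryHypergeometricCoefficient {a b c : ℝ} (h : a + b < c) :
    Summable (fun n => ‖ordinaryHypergeometricCoefficient a b c n‖) := by
  set C := ordinaryHypergeometricCoefficient a b c
  -- `e` is half the gap `c - a - b`: one half absorbs the lower-order terms `ab + ce` once `n` is
  -- large, the other is the gain in `key`, which then telescopes.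
  obtain ⟨e, he, hce⟩ : ∃ e : ℝ, 0 < e ∧ c = a + b + 2 * e := ⟨(c - a - b) / 2, by linarith, by ring⟩
  obtain ⟨N, hN⟩ := exists_nat_ge (|a| + |b| + |c| + e + (|c| * e + |a * b|) / e + 1)
  have hq : 0 ≤ (|c| * e + |a * b|) / e := by positivity
  have key : ∀ n : ℕ, N ≤ n → e * ‖C n‖ ≤ n * ‖C n‖ - (n + 1) * ‖C (n + 1)‖ := by
    intro n hn
    have hn' : (N : ℝ) ≤ n := by exact_mod_cast hn
    have h1 := neg_abs_le a
    have h2 := neg_abs_le b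
    have h3 := neg_abs_le c
    have hc0 := abs_nonneg c
    have ha0 := abs_nonneg a
    have hb0 := abs_nonneg b
    have pa : 0 < a + n := by linarith
    have pb : 0 < b + n := by linarith
    have pc : 0 < c + n := by linarith
    have pn : (0 : ℝ) < n + 1 := by positivity
    have hx : |c| * e + |a * b| ≤ n * e := by
      rw [← div_le_iff₀ he]; linarith
    have hab := neg_abs_le (a * b)
    have hab' := le_abs_self (a * b)
    have hce' : c * e ≤ |c| * e := by gcongr; exact le_abs_self c
    have hle : (a + n) * (b + n) ≤ (c + n) * (n - e) := by nlinarith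
    have hC : ‖C (n + 1)‖ = ‖C n‖ * ((a + n) * (b + n) / ((c + n) * (n + 1))) := by
      rw [show C (n + 1) = _ from ordinaryHypergeometricCoefficient_succ a b c n, norm_mul,
        Real.norm_of_nonneg (by positivity : 0 ≤ (a + n) * (b + n) / ((c + n) * (n + 1)))]
    have h5 : (n + 1) * ((a + n) * (b + n) / ((c + n) * (n + 1))) ≤ n - e := by
      rw [mul_div_assoc', div_le_iff₀ (by positivity)]
      nlinarith
    have := mul_le_mul_of_nonneg_left h5 (norm_nonneg (C n))
    rw [hC]
    nlinarith
  rw [← summable_nat_add_iff N]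
  refine summable_of_sum_range_le (c := N * ‖C N‖ / e) (fun _ => norm_nonneg _) fun m => ?_
  rw [le_div_iff₀ he, Finset.sum_mul]
  have : ∀ m : ℕ, ∑ k ∈ Finset.range m, ‖C (k + N)‖ * e ≤
      N * ‖C N‖ - ((m + N : ℕ) : ℝ) * ‖C (m + N)‖ := by
    intro m
    induction m with
    | zero => simp
    | succ m ih =>
      rw [Finset.sum_range_succ]
      have := key (m + N) (by omega)
      rw [show m + 1 + N = m + N + 1 by ring]
      push_cast at this ih ⊢
      linarith
  have h0 : (0 : ℝ) ≤ ((m + N : ℕ) : ℝ) * ‖C (m + N)‖ := by positivity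
  linarith [this m]

lemma continuousOn_ordinaryHypergeometric_Icc {a b c : ℝ} (h : a + b < c) :
    ContinuousOn (fun x : ℝ => ordinaryHypergeometric a b c x) (Icc 0 1) := by
  rw [ordinaryHypergeometric_eq_tsum]
  refine continuousOn_tsum (fun n => by fun_prop) (summable_ordinaryHypergeometricCoefficient h) ?_
  intro n x hx
  rw [smul_eq_mul, norm_mul]
  refine mul_le_of_le_one_right (norm_nonneg _) ?_
  rw [norm_pow, Real.norm_of_nonneg hx.1]
  exact pow_le_one₀ hx.1 hx.2

lemma hasSum_one_sub_rpow_neg (b : ℝ) {x : ℝ} (hx : |x| < 1) :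
    HasSum (fun n : ℕ => (n ! : ℝ)⁻¹ * (ascPochhammer ℝ n).eval b * x ^ n) ((1 - x) ^ (-b)) := by
  have h := (Real.one_add_rpow_hasFPowerSeriesOnBall_zero (a := -b)).hasSum (y := -x)
    (by simpa [enorm_eq_nnnorm] using! hx)
  -- The binomial series is a `₂F₁` whose second upper and lower parameters coincide and cancel; any
  -- value other than a nonpositive integer would do.
  rw [binomialSeries_eq_ordinaryHypergeometricSeries (b := 1)
    (by intro k; have : (0 : ℝ) ≤ k := k.cast_nonneg
        linarith)] at h
  rw [zero_add, ← sub_eq_add_neg, neg_neg] at h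
  refine (congrArg (HasSum · _) (funext fun n => ?_)).mp h
  have h1 : (ascPochhammer ℝ n).eval 1 = n ! := by simp
  have h2 : (n ! : ℝ) ≠ 0 := by positivity
  rw [FormalMultilinearSeries.compContinuousLinearMap_apply]
  have : (⇑(-ContinuousLinearMap.id ℝ ℝ) ∘ fun _ : Fin n => -x) = fun _ => x := by
    ext; simp
  rw [this, ordinaryHypergeometricSeries_apply_eq, h1, smul_eq_mul]
  field_simp

lemma beta_add_natCast {a e : ℝ} (ha : 0 < a) (he : 0 < e) (n : ℕ) :
    beta (a + n) e =
      beta a e * ((ascPochhammer ℝ n).eval a * ((ascPochhammer ℝ n).eval (a + e))⁻¹) := by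
  induction n with
  | zero => simp
  | succ n ih =>
    have h1 : 0 < a + n := by positivity
    have h2 : 0 < a + e + n := by positivity
    have h3 : beta (a + n + 1) e = beta (a + n) e * ((a + n) * (a + e + n)⁻¹) := by
      rw [beta, beta, Real.Gamma_add_one h1.ne', show a + n + 1 + e = a + e + n + 1 by ring,
        show a + n + e = a + e + n by ring, Real.Gamma_add_one h2.ne']
      have := (Real.Gamma_pos_of_pos h2).ne'
      field_simp
    rw [Nat.cast_succ, ← add_assoc, h3, ih, ascPochhammer_succ_eval, ascPochhammer_succ_eval,
      mul_inv]
    ring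

lemma integrableOn_rpow_mul_one_sub_rpow {a e : ℝ} (ha : 0 < a) (he : 0 < e) :
    IntegrableOn (fun x : ℝ => x ^ (a - 1) * (1 - x) ^ (e - 1)) (Ioo 0 1) := by
  have h := (Complex.betaIntegral_convergent (u := a) (v := e) (by simpa) (by simpa))
  rw [intervalIntegrable_iff_integrableOn_Ioo_of_le zero_le_one] at h
  refine h.re.congr ?_
  filter_upwards [ae_restrict_mem measurableSet_Ioo] with x hx
  have : (x : ℂ) ^ ((a : ℂ) - 1) * (1 - (x : ℂ)) ^ ((e : ℂ) - 1) =
      ((x ^ (a - 1) * (1 - x) ^ (e - 1) : ℝ) : ℂ) := by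
    rw [Complex.ofReal_mul, Complex.ofReal_cpow hx.1.le, Complex.ofReal_cpow (by linarith [hx.2])]
    push_cast; rfl
  simp [this]

lemma integral_rpow_mul_one_sub_rpow {a e : ℝ} (ha : 0 < a) (he : 0 < e) :
    ∫ x in Ioo (0 : ℝ) 1, x ^ (a - 1) * (1 - x) ^ (e - 1) = beta a e := by
  rw [beta_eq_betaIntegralReal a e ha he, Complex.betaIntegral,
    intervalIntegral.integral_of_le zero_le_one, integral_Ioc_eq_integral_Ioo]
  have : ∫ x in Ioo (0 : ℝ) 1, (x : ℂ) ^ ((a : ℂ) - 1) * (1 - (x : ℂ)) ^ ((e : ℂ) - 1) =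
      ∫ x in Ioo (0 : ℝ) 1, ((x ^ (a - 1) * (1 - x) ^ (e - 1) : ℝ) : ℂ) := by
    refine setIntegral_congr_fun measurableSet_Ioo fun x hx => ?_
    rw [Complex.ofReal_mul, Complex.ofReal_cpow hx.1.le, Complex.ofReal_cpow (by linarith [hx.2])]
    push_cast; rfl
  rw [this, integral_complex_ofReal, Complex.ofReal_re]

/-- **Euler's integral** for the Gauss hypergeometric function on `[0, 1]`. -/
lemma integral_euler_hypergeometric {a e b z : ℝ} (ha : 0 < a) (he : 0 < e) (hb : b < e)
    (hz0 : 0 ≤ z) (hz1 : z ≤ 1) :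
    ∫ s in Ioo (0 : ℝ) 1, s ^ (a - 1) * (1 - s) ^ (e - 1) * (1 - z * s) ^ (-b) =
      beta a e * ordinaryHypergeometric a b (a + e) z := by
  set F : ℕ → ℝ → ℝ := fun n s => ((n ! : ℝ)⁻¹ * (ascPochhammer ℝ n).eval b * z ^ n) *
    (s ^ (a + n - 1) * (1 - s) ^ (e - 1)) with hF
  have hpos : ∀ n : ℕ, 0 < a + n := fun n => by positivity
  have hFint : ∀ n, IntegrableOn (F n) (Ioo 0 1) := fun n =>
    (integrableOn_rpow_mul_one_sub_rpow (hpos n) he).const_mul _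
  have hFeq : ∀ n, ∫ s in Ioo (0 : ℝ) 1, F n s =
      beta a e * (ordinaryHypergeometricCoefficient a b (a + e) n * z ^ n) := by
    intro n
    rw [hF, integral_const_mul, integral_rpow_mul_one_sub_rpow (hpos n) he,
      beta_add_natCast ha he]
    simp only [ordinaryHypergeometricCoefficient]
    ring
  have hFnorm : ∀ n, ∫ s in Ioo (0 : ℝ) 1, ‖F n s‖ =
      beta a e * (‖ordinaryHypergeometricCoefficient a b (a + e) n‖ * z ^ n) := by
    intro n
    have h1 : ∀ x : ℝ, 0 < x → 0 < (ascPochhammer ℝ n).eval x := fun x hx => ascPochhammer_pos n x hx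
    have : ∫ s in Ioo (0 : ℝ) 1, ‖F n s‖ = ∫ s in Ioo (0 : ℝ) 1,
        ‖(n ! : ℝ)⁻¹ * (ascPochhammer ℝ n).eval b * z ^ n‖ *
          (s ^ (a + n - 1) * (1 - s) ^ (e - 1)) := by
      refine setIntegral_congr_fun measurableSet_Ioo fun x hx => ?_
      have h2 : 0 < 1 - x := by linarith [hx.2]
      have h3 : 0 < x := hx.1
      simp only [hF]
      rw [norm_mul, Real.norm_of_nonneg (r := x ^ (a + n - 1) * (1 - x) ^ (e - 1)) (by positivity)]
    rw [this, integral_const_mul, integral_rpow_mul_one_sub_rpow (hpos n) he,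
      beta_add_natCast ha he]
    simp only [ordinaryHypergeometricCoefficient, norm_mul, norm_inv, norm_pow,
      Real.norm_of_nonneg hz0, Real.norm_of_nonneg (h1 _ ha).le,
      Real.norm_of_nonneg (h1 _ (add_pos ha he)).le]
    ring
  -- `b < e` is Raabe's condition `a + b < a + e`, so sum and integral may be exchanged even at `z =
  -- 1`.
  have hsum : Summable fun n => ∫ s in Ioo (0 : ℝ) 1, ‖F n s‖ := by
    simp_rw [hFnorm]
    refine Summable.mul_left _ ?_
    refine Summable.of_nonneg_of_le (fun n => by positivity) (fun n => ?_)
      (summable_ordinaryHypergeometricCoefficient (a := a) (b := b) (c := a + e) (by linarith))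
    exact mul_le_of_le_one_right (norm_nonneg _) (pow_le_one₀ hz0 hz1)
  have h := (hasSum_integral_of_summable_integral_norm hFint hsum).tsum_eq
  simp_rw [hFeq] at h
  rw [tsum_mul_left] at h
  rw [ordinaryHypergeometric_eq_tsum]
  simp only [smul_eq_mul]
  rw [h]
  refine setIntegral_congr_fun measurableSet_Ioo fun x hx => ?_
  have h2 : 0 < 1 - x := by linarith [hx.2]
  have hx0 : 0 < x := hx.1
  have hzx : |z * x| < 1 := by
    rw [abs_of_nonneg (by positivity)]
    nlinarith [hx.2]
  have h3 := ((hasSum_one_sub_rpow_neg b hzx).mul_left (x ^ (a - 1) * (1 - x) ^ (e - 1))).tsum_eq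
  rw [← h3]
  refine tsum_congr fun n => ?_
  simp only [hF]
  rw [show a + n - 1 = (a - 1) + n by ring, Real.rpow_add_natCast hx0.ne', mul_pow]
  ring

/-! ### Uniqueness for Laplace transforms. -/

/-- A nonintegrable function has integral `0` by convention, so a positive integral already forces
integrability. -/
lemma ofReal_integral_eq_lintegral_of_integral_pos {α : Type*} [MeasurableSpace α] {μ : Measure α}
    {f : α → ℝ} (hf : 0 ≤ᵐ[μ] f) (h : 0 < ∫ x, f x ∂μ) :
    ∫⁻ x, ENNReal.ofReal (f x) ∂μ = ENNReal.ofReal (∫ x, f x ∂μ) :=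
  (ofReal_integral_eq_lintegral_ofReal (Integrable.of_integral_ne_zero h.ne') hf).symm

/-- Finite measures on `ℝ` are determined by their moment generating functions near `0`. -/
lemma ext_of_mgf_eqOn_Ioo {μ ν : Measure ℝ} [IsFiniteMeasure μ] [IsFiniteMeasure ν] {ε : ℝ}
    (hε : 0 < ε) (hμ : ∀ s ∈ Ioo (-ε) ε, Integrable (fun x => Real.exp (s * x)) μ)
    (hν : ∀ s ∈ Ioo (-ε) ε, Integrable (fun x => Real.exp (s * x)) ν)
    (h : ∀ s ∈ Ioo (-ε) ε, mgf id μ s = mgf id ν s) : μ = ν := by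
  set U : Set ℂ := {z | z.re ∈ Ioo (-ε) ε}
  have hsub : ∀ {m : Measure ℝ}, (∀ s ∈ Ioo (-ε) ε, Integrable (fun x => Real.exp (s * x)) m) →
      U ⊆ {z | z.re ∈ interior (integrableExpSet id m)} := fun hm z hz =>
    interior_maximal (fun s hs => hm s hs) isOpen_Ioo hz
  have hX : AnalyticOnNhd ℂ (complexMGF id μ) U := analyticOnNhd_complexMGF.mono (hsub hμ)
  have hY : AnalyticOnNhd ℂ (complexMGF id ν) U := analyticOnNhd_complexMGF.mono (hsub hν)
  have hU : IsPreconnected U := ((convex_Ioo _ _).linear_preimage Complex.reLm).isPreconnected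
  have h0 : (0 : ℂ) ∈ U := by simp [U, hε]
  have heq : EqOn (complexMGF id μ) (complexMGF id ν) U := by
    refine hX.eqOn_of_preconnected_of_frequently_eq hY hU h0 ?_
    have h_real : ∃ᶠ x : ℝ in 𝓝[≠] 0, complexMGF id μ x = complexMGF id ν x := by
      refine Eventually.frequently ?_
      filter_upwards [nhdsWithin_le_nhds (Ioo_mem_nhds (neg_lt_zero.mpr hε) hε)] with s hs
      rw [complexMGF_ofReal, complexMGF_ofReal, h s hs]
    have ht : Tendsto (fun x : ℝ => (x : ℂ)) (𝓝[≠] 0) (𝓝[≠] 0) := by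
      refine tendsto_nhdsWithin_iff.mpr ⟨?_, ?_⟩
      · exact (Complex.continuous_ofReal.tendsto' 0 0 (by simp)).mono_left nhdsWithin_le_nhds
      · filter_upwards [self_mem_nhdsWithin] with x hx
        simpa using hx
    exact ht.frequently h_real
  -- The strip `U` contains the imaginary axis, where `complexMGF` is the characteristic function.
  refine Measure.ext_of_charFun (funext fun t => ?_)
  rw [← complexMGF_id_mul_I, ← complexMGF_id_mul_I]
  exact heq (by simp [U, hε])

/-- Measures on `ℝ` are determined by their two-sided Laplace transform on `(0, ∞)`. -/
lemma ext_of_lintegral_exp_neg_mul {μ ν : Measure ℝ}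
    (hfin : ∀ t : ℝ, 0 < t → ∫⁻ u, ENNReal.ofReal (Real.exp (-(t * u))) ∂μ ≠ ⊤)
    (h : ∀ t : ℝ, 0 < t → ∫⁻ u, ENNReal.ofReal (Real.exp (-(t * u))) ∂μ =
      ∫⁻ u, ENNReal.ofReal (Real.exp (-(t * u))) ∂ν) : μ = ν := by
  have hmeas : ∀ t : ℝ, Measurable fun u : ℝ => ENNReal.ofReal (Real.exp (-(t * u))) :=
    fun t => by fun_prop
  -- The measures may be infinite. Tilting by `e^(-u)` makes them finite, and `t = 1 - s` turns
  -- Laplace transforms into moment generating functions for `|s| < 1`. As `D` is never `0` or `⊤`,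
  -- the tilt can be undone.
  set D : ℝ → ENNReal := fun u => ENNReal.ofReal (Real.exp (-(1 * u)))
  have hD : Measurable D := hmeas 1
  have htilt : ∀ (m : Measure ℝ) (s : ℝ),
      ∫⁻ u, ENNReal.ofReal (Real.exp (s * u)) ∂(m.withDensity D) =
        ∫⁻ u, ENNReal.ofReal (Real.exp (-((1 - s) * u))) ∂m := by
    intro m s
    rw [lintegral_withDensity_eq_lintegral_mul _ hD (by fun_prop)]
    refine lintegral_congr fun u => ?_
    simp only [Pi.mul_apply, D]
    rw [← ENNReal.ofReal_mul (Real.exp_nonneg _), ← Real.exp_add]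
    ring_nf
  have hfin' : ∀ t : ℝ, 0 < t → ∫⁻ u, ENNReal.ofReal (Real.exp (-(t * u))) ∂ν ≠ ⊤ :=
    fun t ht => h t ht ▸ hfin t ht
  have hFM : ∀ {m : Measure ℝ},
      (∀ t : ℝ, 0 < t → ∫⁻ u, ENNReal.ofReal (Real.exp (-(t * u))) ∂m ≠ ⊤) →
      IsFiniteMeasure (m.withDensity D) := fun hm =>
    isFiniteMeasure_withDensity (hm 1 one_pos)
  have := hFM hfin
  have := hFM hfin'
  have hint : ∀ {m : Measure ℝ},
      (∀ t : ℝ, 0 < t → ∫⁻ u, ENNReal.ofReal (Real.exp (-(t * u))) ∂m ≠ ⊤) →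
      ∀ s ∈ Ioo (-1 : ℝ) 1, Integrable (fun x => Real.exp (s * x)) (m.withDensity D) := by
    intro m hm s hs
    refine ⟨by fun_prop, ?_⟩
    rw [hasFiniteIntegral_iff_ofReal (ae_of_all _ fun x => Real.exp_nonneg _), htilt]
    exact (hm _ (by linarith [hs.2])).lt_top
  have heq : μ.withDensity D = ν.withDensity D := by
    refine ext_of_mgf_eqOn_Ioo one_pos (hint hfin) (hint hfin') fun s hs => ?_
    simp only [mgf, id]
    rw [integral_eq_lintegral_of_nonneg_ae (ae_of_all _ fun x => Real.exp_nonneg _) (by fun_prop),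
      integral_eq_lintegral_of_nonneg_ae (ae_of_all _ fun x => Real.exp_nonneg _) (by fun_prop),
      htilt, htilt, h _ (by linarith [hs.2])]
  have hne0 : ∀ u, D u ≠ 0 := fun u => by simp [D, Real.exp_pos]
  have hneT : ∀ u, D u ≠ ⊤ := fun u => ENNReal.ofReal_ne_top
  rw [← withDensity_inv_same hD (μ := μ) (ae_of_all _ hne0) (ae_of_all _ hneT), heq,
    withDensity_inv_same hD (ae_of_all _ hne0) (ae_of_all _ hneT)]

/-! ### Laplace transform of the Riesz kernel. -/

lemma lintegral_rpow_mul_exp_neg_mul_Ioi {a r : ℝ} (ha : 0 < a) (hr : 0 < r) :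
    ∫⁻ s in Ioi (0 : ℝ), ENNReal.ofReal (s ^ (a - 1) * Real.exp (-(r * s))) =
      ENNReal.ofReal (r ^ (-a) * Real.Gamma a) := by
  have hI := Real.integral_rpow_mul_exp_neg_mul_Ioi ha hr
  have hr' : (1 / r) ^ a = r ^ (-a) := by
    rw [one_div, Real.inv_rpow hr.le, Real.rpow_neg hr.le]
  rw [hr'] at hI
  have hG := Real.Gamma_pos_of_pos ha
  rw [ofReal_integral_eq_lintegral_of_integral_pos _ (by rw [hI]; positivity), hI]
  filter_upwards [ae_restrict_mem measurableSet_Ioi] with s hs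
  have : 0 < s := hs
  simp only [Pi.zero_apply]
  positivity

/-- Complete the square: the product is a Gaussian of rate `s + t` centred at `s y / (s + t)`, times
a factor free of `w`. -/
lemma lintegral_exp_neg_mul_sq_norm_mul_exp {d : ℕ} (y : EuclideanSpace ℝ (Fin d)) {s t : ℝ}
    (hs : 0 < s) (ht : 0 < t) :
    ∫⁻ w : EuclideanSpace ℝ (Fin d), ENNReal.ofReal (Real.exp (-(t * ‖w‖ ^ 2))) *
        ENNReal.ofReal (Real.exp (-(s * ‖w - y‖ ^ 2))) =
      ENNReal.ofReal ((Real.pi / (s + t)) ^ ((d : ℝ) / 2) *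
        Real.exp (-(s * t / (s + t) * ‖y‖ ^ 2))) := by
  have hst : 0 < s + t := by positivity
  have h1 : ∀ w : EuclideanSpace ℝ (Fin d), ENNReal.ofReal (Real.exp (-(t * ‖w‖ ^ 2))) *
      ENNReal.ofReal (Real.exp (-(s * ‖w - y‖ ^ 2))) =
      ENNReal.ofReal (Real.exp (-(s + t) * ‖w - (s / (s + t)) • y‖ ^ 2)) *
        ENNReal.ofReal (Real.exp (-(s * t / (s + t) * ‖y‖ ^ 2))) := by
    intro w
    rw [← ENNReal.ofReal_mul (Real.exp_nonneg _), ← ENNReal.ofReal_mul (Real.exp_nonneg _),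
      ← Real.exp_add, ← Real.exp_add]
    congr 2
    rw [norm_sub_sq_real, norm_sub_sq_real, inner_smul_right, norm_smul,
      Real.norm_of_nonneg (by positivity)]
    field_simp
    ring
  have hI := GaussianFourier.integral_rexp_neg_mul_sq_norm
    (V := EuclideanSpace ℝ (Fin d)) hst
  rw [finrank_euclideanSpace_fin] at hI
  simp_rw [h1]
  rw [lintegral_mul_const _ (by fun_prop),
    lintegral_sub_right_eq_self (fun w : EuclideanSpace ℝ (Fin d) =>
      ENNReal.ofReal (Real.exp (-(s + t) * ‖w‖ ^ 2))),
    ofReal_integral_eq_lintegral_of_integral_pos (ae_of_all _ fun w => Real.exp_nonneg _)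
      (by rw [hI]; positivity), hI, ← ENNReal.ofReal_mul (by positivity)]

/-- The substitution `s = t x / (1 - x)`. -/
lemma lintegral_Ioi_eq_lintegral_Ioo_div {t : ℝ} (ht : 0 < t) (f : ℝ → ENNReal) :
    ∫⁻ s in Ioi (0 : ℝ), f s =
      ∫⁻ x in Ioo (0 : ℝ) 1, ENNReal.ofReal (t / (1 - x) ^ 2) * f (t * x / (1 - x)) := by
  have himg : (fun x : ℝ => t * x / (1 - x)) '' Ioo 0 1 = Ioi 0 := by
    ext s
    simp only [mem_image, mem_Ioo, mem_Ioi]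
    constructor
    · rintro ⟨x, ⟨h0, h1⟩, rfl⟩
      have : 0 < 1 - x := by linarith
      positivity
    · intro hs
      have hst : 0 < s + t := by positivity
      refine ⟨s / (s + t), ⟨by positivity, by rw [div_lt_one hst]; linarith⟩, ?_⟩
      have : 1 - s / (s + t) = t / (s + t) := by field_simp; ring
      rw [this]
      field_simp
  have hderiv : ∀ x ∈ Ioo (0 : ℝ) 1,
      HasDerivWithinAt (fun x : ℝ => t * x / (1 - x)) (t / (1 - x) ^ 2) (Ioo 0 1) x := by
    intro x hx
    have h1 : 1 - x ≠ 0 := by linarith [hx.2]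
    have := ((hasDerivAt_id x).const_mul t).div ((hasDerivAt_id x).const_sub 1) h1
    refine (this.congr_deriv ?_).hasDerivWithinAt
    simp only [id]
    congr 1
    ring
  have hinj : InjOn (fun x : ℝ => t * x / (1 - x)) (Ioo 0 1) := by
    intro x hx z hz hxz
    have h1 : 1 - x ≠ 0 := by linarith [hx.2]
    have h2 : 1 - z ≠ 0 := by linarith [hz.2]
    simp only at hxz
    rw [div_eq_div_iff h1 h2] at hxz
    have : t * (x - z) = 0 := by linarith
    rcases mul_eq_zero.mp this with h | h
    · exact absurd h ht.ne'
    · linarith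
  rw [← himg, lintegral_image_eq_lintegral_abs_deriv_mul measurableSet_Ioo hderiv hinj]
  refine setLIntegral_congr_fun measurableSet_Ioo fun x hx => ?_
  have h1 : 0 < 1 - x := by linarith [hx.2]
  rw [abs_of_pos (by positivity)]

/-- The Laplace transform, in the squared norm, of the kernel `‖w - y‖ ^ (-2 a)`. -/
lemma lintegral_exp_neg_mul_sq_norm_mul_rpow {d : ℕ} (hd : 1 ≤ d) (y : EuclideanSpace ℝ (Fin d))
    {a t : ℝ} (ha : 0 < a) (ht : 0 < t) :
    ∫⁻ w : EuclideanSpace ℝ (Fin d), ENNReal.ofReal (Real.exp (-(t * ‖w‖ ^ 2))) *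
        ENNReal.ofReal (‖w - y‖ ^ (-(2 * a))) =
      ENNReal.ofReal (Real.pi ^ ((d : ℝ) / 2) / Real.Gamma a * t ^ (a - (d : ℝ) / 2)) *
        ∫⁻ x in Ioo (0 : ℝ) 1, ENNReal.ofReal (x ^ (a - 1) * (1 - x) ^ ((d : ℝ) / 2 - a - 1) *
          Real.exp (-(t * (‖y‖ ^ 2 * x)))) := by
  have : Nonempty (Fin d) := ⟨⟨0, hd⟩⟩
  have hG := Real.Gamma_pos_of_pos ha
  have h1 : ∀ᵐ w : EuclideanSpace ℝ (Fin d), ENNReal.ofReal (Real.exp (-(t * ‖w‖ ^ 2))) *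
        ENNReal.ofReal (‖w - y‖ ^ (-(2 * a))) =
      ENNReal.ofReal (1 / Real.Gamma a) * ∫⁻ s in Ioi (0 : ℝ), ENNReal.ofReal (s ^ (a - 1)) *
        (ENNReal.ofReal (Real.exp (-(t * ‖w‖ ^ 2))) *
          ENNReal.ofReal (Real.exp (-(s * ‖w - y‖ ^ 2)))) := by
    -- At `w = y` the real power has the default value `0` while the Gamma integral diverges; this
    -- point is null because `d ≥ 1`.
    filter_upwards [compl_mem_ae_iff.mpr (measure_singleton y)] with w hw
    have hw' : 0 < ‖w - y‖ := norm_pos_iff.mpr (sub_ne_zero.mpr hw)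
    have h2 : ∀ s ∈ Ioi (0 : ℝ), ENNReal.ofReal (s ^ (a - 1)) *
        (ENNReal.ofReal (Real.exp (-(t * ‖w‖ ^ 2))) *
          ENNReal.ofReal (Real.exp (-(s * ‖w - y‖ ^ 2)))) =
        ENNReal.ofReal (Real.exp (-(t * ‖w‖ ^ 2))) *
          ENNReal.ofReal (s ^ (a - 1) * Real.exp (-(‖w - y‖ ^ 2 * s))) := by
      intro s hs
      have : (0 : ℝ) < s := hs
      rw [ENNReal.ofReal_mul (by positivity), mul_comm s]
      ring
    have h3 : ‖w - y‖ ^ (-(2 * a)) =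
        1 / Real.Gamma a * ((‖w - y‖ ^ 2) ^ (-a) * Real.Gamma a) := by
      rw [← Real.rpow_natCast, ← Real.rpow_mul hw'.le]
      push_cast
      field_simp
    rw [setLIntegral_congr_fun measurableSet_Ioi h2, lintegral_const_mul _ (by fun_prop),
      lintegral_rpow_mul_exp_neg_mul_Ioi ha (by positivity), mul_left_comm,
      ← ENNReal.ofReal_mul (p := 1 / Real.Gamma a) (by positivity), ← h3]
  rw [lintegral_congr_ae h1, lintegral_const_mul _ (by fun_prop), lintegral_lintegral_swap
    (by fun_prop)]
  have h3 : ∀ s ∈ Ioi (0 : ℝ), ∫⁻ w : EuclideanSpace ℝ (Fin d), ENNReal.ofReal (s ^ (a - 1)) *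
        (ENNReal.ofReal (Real.exp (-(t * ‖w‖ ^ 2))) *
          ENNReal.ofReal (Real.exp (-(s * ‖w - y‖ ^ 2)))) =
      ENNReal.ofReal (s ^ (a - 1) * ((Real.pi / (s + t)) ^ ((d : ℝ) / 2) *
        Real.exp (-(s * t / (s + t) * ‖y‖ ^ 2)))) := by
    intro s hs
    have : (0 : ℝ) < s := hs
    rw [lintegral_const_mul _ (by fun_prop), lintegral_exp_neg_mul_sq_norm_mul_exp y hs ht,
      ← ENNReal.ofReal_mul (by positivity)]
  -- With `s = t x / (1 - x)`, the Gaussian rate `s t / (s + t)` becomes `t x`, linear in `t`, so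
  -- the result is again a Laplace transform.
  rw [setLIntegral_congr_fun measurableSet_Ioi h3, lintegral_Ioi_eq_lintegral_Ioo_div ht,
    ← lintegral_const_mul _ (by fun_prop), ← lintegral_const_mul _ (by fun_prop)]
  refine setLIntegral_congr_fun measurableSet_Ioo fun x hx => ?_
  have hx0 : 0 < x := hx.1
  have hx1 : 0 < 1 - x := by linarith [hx.2]
  have e1 : t * x / (1 - x) + t = t / (1 - x) := by field_simp; ring
  have e2 : t * x / (1 - x) * t / (t / (1 - x)) * ‖y‖ ^ 2 = t * (‖y‖ ^ 2 * x) := by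
    field_simp
  rw [e1, e2, ← ENNReal.ofReal_mul (by positivity), ← ENNReal.ofReal_mul (by positivity),
    ← ENNReal.ofReal_mul (by positivity)]
  congr 1
  rw [Real.div_rpow (by positivity) hx1.le, Real.mul_rpow ht.le hx0.le,
    Real.div_rpow Real.pi_pos.le (by positivity), Real.div_rpow ht.le hx1.le,
    Real.rpow_sub hx1 ((d : ℝ) / 2 - a), Real.rpow_sub hx1 ((d : ℝ) / 2),
    Real.rpow_sub ht a ((d : ℝ) / 2), Real.rpow_sub ht a 1, Real.rpow_sub hx1 a 1,
    Real.rpow_one, Real.rpow_one]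
  field_simp

/-! ### The law of the squared norm. -/

section MapWithDensity

variable {α : Type*} [MeasurableSpace α] {m : Measure α} {ρ X : α → ℝ} {f : ℝ → ℝ}

lemma integrable_map_withDensity_ofReal_iff (hρ : Measurable ρ) (hρ0 : 0 ≤ᵐ[m] ρ)
    (hX : Measurable X) (hf : Measurable f) :
    Integrable f ((m.withDensity fun w => ENNReal.ofReal (ρ w)).map X) ↔
      Integrable (fun w => f (X w) * ρ w) m := by
  rw [integrable_map_measure hf.aestronglyMeasurable hX.aemeasurable,
    integrable_withDensity_iff_integrable_smul' (by fun_prop) (by simp)]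
  refine integrable_congr ?_
  filter_upwards [hρ0] with w hw
  simp [ENNReal.toReal_ofReal hw, mul_comm]

lemma integral_map_withDensity_ofReal (hρ : Measurable ρ) (hρ0 : 0 ≤ᵐ[m] ρ)
    (hX : Measurable X) (hf : Measurable f) :
    ∫ u, f u ∂((m.withDensity fun w => ENNReal.ofReal (ρ w)).map X) = ∫ w, f (X w) * ρ w ∂m := by
  rw [integral_map hX.aemeasurable hf.aestronglyMeasurable,
    integral_withDensity_eq_integral_toReal_smul (by fun_prop) (by simp)]
  refine integral_congr_ae ?_
  filter_upwards [hρ0] with w hw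
  simp [ENNReal.toReal_ofReal hw, mul_comm]

lemma lintegral_map_withDensity_ofReal (hρ : Measurable ρ) (hX : Measurable X) {g : ℝ → ENNReal}
    (hg : Measurable g) :
    ∫⁻ u, g u ∂((m.withDensity fun w => ENNReal.ofReal (ρ w)).map X) =
      ∫⁻ w, g (X w) * ENNReal.ofReal (ρ w) ∂m := by
  rw [lintegral_map hg hX, lintegral_withDensity_eq_lintegral_mul _ (by fun_prop) (by fun_prop)]
  simp [mul_comm]

end MapWithDensity

lemma ae_restrict_prod_mem :
    ∀ᵐ p : ℝ × ℝ ∂((volume.restrict (Ioo 0 1)).prod (volume.restrict (Ioi 0))),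
      (0 < p.1 ∧ p.1 < 1) ∧ 0 < p.2 := by
  rw [Measure.prod_restrict]
  filter_upwards [ae_restrict_mem (measurableSet_Ioo.prod measurableSet_Ioi)] with p hp
  exact hp

/-- The distribution of `‖w‖ ^ 2` under `‖w - y‖ ^ (-2 a) dw`, in the form of Copson's
factorization of the spherical means of the Riesz kernel. -/
lemma map_sq_norm_withDensity_rpow_eq {d : ℕ} (hd : 1 ≤ d) (y : EuclideanSpace ℝ (Fin d))
    {a h : ℝ} (ha : 0 < a) (hh : 0 < h) (hah : a + h = (d : ℝ) / 2) :
    ((volume : Measure (EuclideanSpace ℝ (Fin d))).withDensity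
        fun w => ENNReal.ofReal (‖w - y‖ ^ (-(2 * a)))).map (fun w => ‖w‖ ^ 2) =
      ENNReal.ofReal (Real.pi ^ ((d : ℝ) / 2) / (Real.Gamma a * Real.Gamma h)) •
        (((volume.restrict (Ioo 0 1)).prod (volume.restrict (Ioi 0))).withDensity
          fun p : ℝ × ℝ => ENNReal.ofReal
            (p.1 ^ (a - 1) * (1 - p.1) ^ (h - 1) * p.2 ^ (h - 1))).map
              (fun p => p.2 + ‖y‖ ^ 2 * p.1) := by
  have hGa := Real.Gamma_pos_of_pos ha
  have hGh := Real.Gamma_pos_of_pos hh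
  have hL : ∀ t : ℝ, 0 < t → ∫⁻ u, ENNReal.ofReal (Real.exp (-(t * u)))
      ∂(((volume : Measure (EuclideanSpace ℝ (Fin d))).withDensity
        fun w => ENNReal.ofReal (‖w - y‖ ^ (-(2 * a)))).map (fun w => ‖w‖ ^ 2)) =
      ENNReal.ofReal (Real.pi ^ ((d : ℝ) / 2) / Real.Gamma a * t ^ (-h)) *
        ∫⁻ x in Ioo (0 : ℝ) 1, ENNReal.ofReal (x ^ (a - 1) * (1 - x) ^ (h - 1) *
          Real.exp (-(t * (‖y‖ ^ 2 * x)))) := by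
    intro t ht
    rw [lintegral_map_withDensity_ofReal (by fun_prop) (by fun_prop) (by fun_prop),
      lintegral_exp_neg_mul_sq_norm_mul_rpow hd y ha ht, ← hah]
    simp only [add_sub_cancel_left, sub_add_cancel_left]
  refine ext_of_lintegral_exp_neg_mul (fun t ht => ?_) (fun t ht => ?_)
  · rw [hL t ht]
    refine ENNReal.mul_ne_top ENNReal.ofReal_ne_top (ne_of_lt ?_)
    refine lt_of_le_of_lt (setLIntegral_mono' measurableSet_Ioo (fun x hx => ?_))
      (integrableOn_rpow_mul_one_sub_rpow ha hh).lintegral_lt_top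
    have hx0 : 0 < x := hx.1
    have hx1 : 0 < 1 - x := by linarith [hx.2]
    refine ENNReal.ofReal_le_ofReal (mul_le_of_le_one_right (by positivity) ?_)
    rw [Real.exp_le_one_iff, neg_nonpos]
    positivity
  · rw [hL t ht, lintegral_smul_measure, smul_eq_mul,
      lintegral_map_withDensity_ofReal (by fun_prop) (by fun_prop) (by fun_prop),
      lintegral_prod _ (by fun_prop)]
    -- The exponential of the sum `r + |y|²x` splits, and the `r`-factor integrates to `t^(-h)
    -- Γ(h)`.
    have hinner : ∀ x ∈ Ioo (0 : ℝ) 1, ∫⁻ r in Ioi (0 : ℝ),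
        ENNReal.ofReal (Real.exp (-(t * (r + ‖y‖ ^ 2 * x)))) *
          ENNReal.ofReal (x ^ (a - 1) * (1 - x) ^ (h - 1) * r ^ (h - 1)) =
        ENNReal.ofReal (t ^ (-h) * Real.Gamma h) *
          ENNReal.ofReal (x ^ (a - 1) * (1 - x) ^ (h - 1) *
            Real.exp (-(t * (‖y‖ ^ 2 * x)))) := by
      intro x hx
      have hx0 : 0 < x := hx.1
      have hx1 : 0 < 1 - x := by linarith [hx.2]
      rw [← lintegral_rpow_mul_exp_neg_mul_Ioi hh ht, ← lintegral_mul_const _ (by fun_prop)]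
      refine setLIntegral_congr_fun measurableSet_Ioi fun r hr => ?_
      have hr0 : (0 : ℝ) < r := hr
      rw [← ENNReal.ofReal_mul (by positivity), ← ENNReal.ofReal_mul (by positivity), mul_add,
        neg_add, Real.exp_add]
      ring_nf
    rw [setLIntegral_congr_fun measurableSet_Ioo hinner, lintegral_const_mul _ (by fun_prop),
      ← mul_assoc, ← ENNReal.ofReal_mul (by positivity)]
    congr 2
    field_simp

/-! ### The potential for `β < d`. -/

lemma integrableOn_max_sub_rpow_mul_rpow {p h : ℝ} (hp : 0 < p) (hh : 0 < h) :
    IntegrableOn (fun r : ℝ => max (1 - r) 0 ^ p * r ^ (h - 1)) (Ioi 0) := by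
  have h1 := integrableOn_rpow_mul_one_sub_rpow hh (e := p + 1) (by positivity)
  rw [← Ioo_union_Ici_eq_Ioi (zero_lt_one' ℝ)]
  refine IntegrableOn.union (h1.congr_fun (fun r hr => ?_) measurableSet_Ioo)
    (integrableOn_zero.congr_fun (fun r hr => ?_) measurableSet_Ici)
  · have : 0 < 1 - r := by linarith [hr.2]
    simp only [add_sub_cancel_right]
    rw [max_eq_left this.le, mul_comm]
  · have : 1 - r ≤ 0 := by linarith [mem_Ici.mp hr]
    beta_reduce
    rw [max_eq_right this, Real.zero_rpow hp.ne', zero_mul]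

/-- For `c > 0`, the scaling `r = c x` reduces to a Beta integral; for `c ≤ 0` both sides vanish
because the exponents are positive. -/
lemma integral_max_sub_rpow_mul_rpow {p h : ℝ} (hp : 0 < p) (hh : 0 < h) (c : ℝ) :
    ∫ r in Ioi (0 : ℝ), max (c - r) 0 ^ p * r ^ (h - 1) = beta h (p + 1) * max c 0 ^ (p + h) := by
  rcases le_or_gt c 0 with hc | hc
  · rw [max_eq_right hc, Real.zero_rpow (by positivity), mul_zero]
    refine setIntegral_eq_zero_of_forall_eq_zero fun r hr => ?_
    have : c - r ≤ 0 := by linarith [mem_Ioi.mp hr]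
    rw [max_eq_right this, Real.zero_rpow hp.ne', zero_mul]
  · have h1 := integral_comp_mul_left_Ioi' (fun r => max (c - r) 0 ^ p * r ^ (h - 1)) 0 hc
    rw [mul_zero] at h1
    rw [← h1, max_eq_left hc.le]
    have h2 : ∀ x ∈ Ioi (0 : ℝ), max (c - c * x) 0 ^ p * (c * x) ^ (h - 1) =
        c ^ (p + h - 1) * (max (1 - x) 0 ^ p * x ^ (h - 1)) := by
      intro x hx
      have hx0 : (0 : ℝ) < x := hx
      have : max (c - c * x) 0 = c * max (1 - x) 0 := by
        rw [mul_max_of_nonneg _ _ hc.le, mul_zero, mul_sub, mul_one]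
      rw [this, Real.mul_rpow hc.le (le_max_right _ _), Real.mul_rpow hc.le hx0.le,
        add_sub_assoc, Real.rpow_add hc]
      ring
    rw [setIntegral_congr_fun measurableSet_Ioi h2, integral_const_mul,
      setIntegral_eq_of_subset_of_forall_sdiff_eq_zero measurableSet_Ioi
        (Ioo_subset_Ioi_self : Ioo 0 1 ⊆ Ioi (0 : ℝ))]
    · have h3 : ∀ x ∈ Ioo (0 : ℝ) 1, max (1 - x) 0 ^ p * x ^ (h - 1) =
          x ^ (h - 1) * (1 - x) ^ (p + 1 - 1) := by
        intro x hx
        have : 0 < 1 - x := by linarith [hx.2]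
        rw [add_sub_cancel_right, max_eq_left this.le, mul_comm]
      rw [setIntegral_congr_fun measurableSet_Ioo h3,
        integral_rpow_mul_one_sub_rpow hh (by positivity), Real.rpow_sub_one hc.ne', smul_eq_mul]
      field_simp
    · intro x hx
      have h4 : (0 : ℝ) < x := hx.1
      have : 1 - x ≤ 0 := by
        by_contra! h5
        exact hx.2 ⟨h4, by linarith⟩
      rw [max_eq_right this, Real.zero_rpow hp.ne', zero_mul]

lemma integral_max_one_sub_sq_norm_mul_rpow {d : ℕ} (hd : 1 ≤ d) (y : EuclideanSpace ℝ (Fin d))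
    {a h p : ℝ} (ha : 0 < a) (hh : 0 < h) (hah : a + h = (d : ℝ) / 2) (hp : 0 < p) :
    Integrable (fun w : EuclideanSpace ℝ (Fin d) =>
      max (1 - ‖w‖ ^ 2) 0 ^ p * ‖w - y‖ ^ (-(2 * a))) ∧
    ∫ w : EuclideanSpace ℝ (Fin d), max (1 - ‖w‖ ^ 2) 0 ^ p * ‖w - y‖ ^ (-(2 * a)) =
      Real.pi ^ ((d : ℝ) / 2) / (Real.Gamma a * Real.Gamma h) * beta h (p + 1) *
        ∫ x in Ioo (0 : ℝ) 1,
          x ^ (a - 1) * (1 - x) ^ (h - 1) * max (1 - ‖y‖ ^ 2 * x) 0 ^ (p + h) := by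
  have hGa := Real.Gamma_pos_of_pos ha
  have hGh := Real.Gamma_pos_of_pos hh
  have hf : Measurable fun u : ℝ => max (1 - u) 0 ^ p := by fun_prop
  have hmap := map_sq_norm_withDensity_rpow_eq hd y ha hh hah
  have hρ0 : 0 ≤ᵐ[volume] fun w : EuclideanSpace ℝ (Fin d) => ‖w - y‖ ^ (-(2 * a)) :=
    ae_of_all _ fun w => by simp only [Pi.zero_apply]; positivity
  have hσ0 : 0 ≤ᵐ[(volume.restrict (Ioo 0 1)).prod (volume.restrict (Ioi 0))]
      fun p : ℝ × ℝ => p.1 ^ (a - 1) * (1 - p.1) ^ (h - 1) * p.2 ^ (h - 1) := by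
    filter_upwards [ae_restrict_prod_mem] with q hq
    have : 0 < 1 - q.1 := by linarith [hq.1.2]
    have h1 := hq.1.1
    have h2 := hq.2
    simp only [Pi.zero_apply]
    positivity
  have hprod : Integrable (fun q : ℝ × ℝ => max (1 - (q.2 + ‖y‖ ^ 2 * q.1)) 0 ^ p *
      (q.1 ^ (a - 1) * (1 - q.1) ^ (h - 1) * q.2 ^ (h - 1)))
      ((volume.restrict (Ioo 0 1)).prod (volume.restrict (Ioi 0))) := by
    -- Dropping `|y|²x ≥ 0` only enlarges the profile and leaves a product of one-variable
    -- integrands.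
    refine Integrable.mono' ((integrableOn_rpow_mul_one_sub_rpow ha hh).mul_prod
      (integrableOn_max_sub_rpow_mul_rpow hp hh)) (by fun_prop) ?_
    filter_upwards [ae_restrict_prod_mem] with q hq
    have : 0 < 1 - q.1 := by linarith [hq.1.2]
    have h1 := hq.1.1
    have h2 := hq.2
    rw [Real.norm_of_nonneg (by positivity)]
    have h3 : max (1 - (q.2 + ‖y‖ ^ 2 * q.1)) 0 ^ p ≤ max (1 - q.2) 0 ^ p := by
      gcongr
      have : 0 ≤ ‖y‖ ^ 2 * q.1 := by positivity
      linarith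
    calc _ ≤ max (1 - q.2) 0 ^ p * (q.1 ^ (a - 1) * (1 - q.1) ^ (h - 1) * q.2 ^ (h - 1)) := by
          gcongr
      _ = _ := by ring
  constructor
  · rw [← integrable_map_withDensity_ofReal_iff (X := fun w => ‖w‖ ^ 2) (by fun_prop) hρ0
      (by fun_prop) hf, hmap]
    exact ((integrable_map_withDensity_ofReal_iff (by fun_prop) hσ0 (by fun_prop) hf).mpr
      hprod).smul_measure ENNReal.ofReal_ne_top
  · rw [← integral_map_withDensity_ofReal (X := fun w => ‖w‖ ^ 2)
      (f := fun u : ℝ => max (1 - u) 0 ^ p) (by fun_prop) hρ0 (by fun_prop) hf, hmap,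
      integral_smul_measure, ENNReal.toReal_ofReal (by positivity),
      integral_map_withDensity_ofReal (by fun_prop) hσ0 (by fun_prop) hf,
      integral_prod _ hprod, smul_eq_mul, mul_assoc, ← integral_const_mul (beta h (p + 1))]
    congr 1
    refine setIntegral_congr_fun measurableSet_Ioo fun x hx => ?_
    rw [mul_left_comm, ← integral_max_sub_rpow_mul_rpow hp hh, ← integral_const_mul]
    refine integral_congr_ae (ae_of_all _ fun r => ?_)
    beta_reduce
    rw [show 1 - ‖y‖ ^ 2 * x - r = 1 - (r + ‖y‖ ^ 2 * x) by ring]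
    ring

lemma integral_Ioo_mul_max_one_sub_rpow_of_le_one {a h q v : ℝ} (ha : 0 < a) (hh : 0 < h)
    (hq : 0 < q) (hv0 : 0 ≤ v) (hv1 : v ≤ 1) :
    ∫ x in Ioo (0 : ℝ) 1, x ^ (a - 1) * (1 - x) ^ (h - 1) * max (1 - v * x) 0 ^ q =
      beta a h * ordinaryHypergeometric a (-q) (a + h) v := by
  rw [← integral_euler_hypergeometric ha hh (by linarith) hv0 hv1]
  refine setIntegral_congr_fun measurableSet_Ioo fun x hx => ?_
  have : 0 ≤ 1 - v * x := by nlinarith [hx.1, hx.2]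
  simp only [neg_neg]
  rw [max_eq_left this]

/-- The integrand lives on `x < 1/v`. The substitution `s = v x` exchanges the roles of the factors
`1 - x` and `1 - v x`, giving Euler's integral at argument `1/v`. -/
lemma integral_Ioo_mul_max_one_sub_rpow_of_one_le {a h q v : ℝ} (ha : 0 < a) (hh : 0 < h)
    (hq : 0 < q) (hv1 : 1 ≤ v) :
    ∫ x in Ioo (0 : ℝ) 1, x ^ (a - 1) * (1 - x) ^ (h - 1) * max (1 - v * x) 0 ^ q =
      v ^ (-a) * beta a (q + 1) * ordinaryHypergeometric a (1 - h) (a + q + 1) (1 / v) := by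
  have hv : 0 < v := by linarith
  rw [mul_assoc, add_assoc a, ← integral_euler_hypergeometric ha (by positivity) (by linarith)
    (by positivity) ((div_le_one hv).mpr hv1)]
  have hzero : ∀ x, x ∉ Ioo (0 : ℝ) 1 → 0 < x → max (1 - x) 0 ^ q = 0 := by
    intro x hx hx0
    rw [max_eq_right, Real.zero_rpow hq.ne']
    by_contra! h1
    exact hx ⟨hx0, by linarith⟩
  -- Both integrals are extended to the half-line, where scaling preserves the domain. Powers of
  -- negative bases that appear there are multiplied by a vanishing `max` factor.
  have h1 : ∫ x in Ioo (0 : ℝ) 1, x ^ (a - 1) * (1 - x) ^ (h - 1) * max (1 - v * x) 0 ^ q =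
      ∫ x in Ioi (0 : ℝ), x ^ (a - 1) * (1 - x) ^ (h - 1) * max (1 - v * x) 0 ^ q := by
    refine (setIntegral_eq_of_subset_of_forall_sdiff_eq_zero measurableSet_Ioi
      Ioo_subset_Ioi_self fun x hx => ?_).symm
    have hx0 : (0 : ℝ) < x := hx.1
    have hx1 : 1 ≤ x := by
      by_contra! h1
      exact hx.2 ⟨hx0, h1⟩
    rw [max_eq_right (by nlinarith), Real.zero_rpow hq.ne', mul_zero]
  have h2 : ∫ s in Ioo (0 : ℝ) 1,
        s ^ (a - 1) * (1 - s) ^ (q + 1 - 1) * (1 - 1 / v * s) ^ (-(1 - h)) =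
      ∫ s in Ioi (0 : ℝ), s ^ (a - 1) * max (1 - s) 0 ^ q * (1 - 1 / v * s) ^ (h - 1) := by
    rw [setIntegral_eq_of_subset_of_forall_sdiff_eq_zero (s := Ioo 0 1) measurableSet_Ioi
      Ioo_subset_Ioi_self fun x hx => by rw [hzero x hx.2 hx.1, mul_zero, zero_mul]]
    refine setIntegral_congr_fun measurableSet_Ioo fun x hx => ?_
    have : 0 < 1 - x := by linarith [hx.2]
    simp only [add_sub_cancel_right, neg_sub]
    rw [max_eq_left this.le]
  have h3 := integral_comp_mul_left_Ioi'
    (fun s => s ^ (a - 1) * max (1 - s) 0 ^ q * (1 - 1 / v * s) ^ (h - 1)) 0 hv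
  rw [mul_zero] at h3
  rw [h1, h2, ← h3, smul_eq_mul, ← mul_assoc, ← integral_const_mul]
  refine setIntegral_congr_fun measurableSet_Ioi fun x hx => ?_
  have hx0 : (0 : ℝ) < x := hx
  rw [Real.mul_rpow hv.le hx0.le, show 1 / v * (v * x) = x by field_simp,
    Real.rpow_sub_one hv.ne', Real.rpow_neg hv.le]
  field_simp

lemma rieszIntegrand_ballProfile_eq {d : ℕ} (β γ : ℝ) (y z : EuclideanSpace ℝ (Fin d)) :
    rieszIntegrand β (ballProfile γ) y z =
      max (1 - ‖y + z‖ ^ 2) 0 ^ (γ / 2) * ‖y + z - y‖ ^ (-(2 * (((d : ℝ) - β) / 2))) := by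
  rw [rieszIntegrand, ballProfile, add_sub_cancel_left, mul_div_cancel₀ _ two_ne_zero,
    Real.rpow_neg (norm_nonneg z), div_eq_mul_inv]

/-- The potential of the ball profile, without its normalising constant, for `β < d`. -/
lemma integral_rieszIntegrand_ballProfile_of_lt {d : ℕ} (hd : 1 ≤ d) {β γ : ℝ} (hβ : 0 < β)
    (hβd : β < d) (hγ : 0 < γ) (y : EuclideanSpace ℝ (Fin d)) :
    Integrable (rieszIntegrand β (ballProfile γ) y) ∧
    (‖y‖ ≤ 1 → ∫ z, rieszIntegrand β (ballProfile γ) y z =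
      Real.pi ^ ((d : ℝ) / 2) * Real.Gamma (γ / 2 + 1) / Real.Gamma ((d : ℝ) / 2) *
        Real.Gamma (β / 2) * (Real.Gamma ((β + γ) / 2 + 1))⁻¹ *
        ordinaryHypergeometric (((d : ℝ) - β) / 2) (-((γ + β) / 2)) ((d : ℝ) / 2) (‖y‖ ^ 2)) ∧
    (1 ≤ ‖y‖ → ∫ z, rieszIntegrand β (ballProfile γ) y z =
      Real.pi ^ ((d : ℝ) / 2) * Real.Gamma (γ / 2 + 1) / Real.Gamma (((d : ℝ) + γ) / 2 + 1) *
        ‖y‖ ^ (β - (d : ℝ)) *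
        ordinaryHypergeometric (((d : ℝ) - β) / 2) ((2 - β) / 2) (((d : ℝ) + γ) / 2 + 1)
          (1 / ‖y‖ ^ 2)) := by
  set a : ℝ := ((d : ℝ) - β) / 2 with ha_def
  have ha : 0 < a := by rw [ha_def]; linarith
  have hh : 0 < β / 2 := by positivity
  have hp : 0 < γ / 2 := by positivity
  have hah : a + β / 2 = (d : ℝ) / 2 := by rw [ha_def]; ring
  have hq : 0 < γ / 2 + β / 2 := by positivity
  have hGa := (Real.Gamma_pos_of_pos ha).ne'
  have hGh := (Real.Gamma_pos_of_pos hh).ne'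
  have hGq := (Real.Gamma_pos_of_pos (show 0 < (β + γ) / 2 + 1 by positivity)).ne'
  obtain ⟨hint, heq⟩ := integral_max_one_sub_sq_norm_mul_rpow hd y ha hh hah hp
  have hfun : rieszIntegrand β (ballProfile γ) y = fun z =>
      max (1 - ‖y + z‖ ^ 2) 0 ^ (γ / 2) * ‖y + z - y‖ ^ (-(2 * a)) :=
    funext fun z => rieszIntegrand_ballProfile_eq β γ y z
  have hJ : ∫ z, rieszIntegrand β (ballProfile γ) y z = _ :=
    (congrArg (fun f => ∫ z, f z) hfun).trans ((integral_add_left_eq_self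
      (fun w => max (1 - ‖w‖ ^ 2) 0 ^ (γ / 2) * ‖w - y‖ ^ (-(2 * a))) y).trans heq)
  have hB : beta (β / 2) (γ / 2 + 1) =
      Real.Gamma (β / 2) * Real.Gamma (γ / 2 + 1) / Real.Gamma ((β + γ) / 2 + 1) := by
    rw [beta, show β / 2 + (γ / 2 + 1) = (β + γ) / 2 + 1 by ring]
  refine ⟨hfun ▸ hint.comp_add_left y, fun hy => ?_, fun hy => ?_⟩
  · rw [hJ, integral_Ioo_mul_max_one_sub_rpow_of_le_one ha hh hq (by positivity)
      (pow_le_one₀ (norm_nonneg y) hy), hB, beta, hah,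
      show -(γ / 2 + β / 2) = -((γ + β) / 2) by ring]
    field_simp
  · have hy0 : 0 < ‖y‖ := by linarith
    rw [hJ, integral_Ioo_mul_max_one_sub_rpow_of_one_le ha hh hq (one_le_pow₀ hy), hB, beta,
      show a + (γ / 2 + β / 2) + 1 = ((d : ℝ) + γ) / 2 + 1 by rw [ha_def]; ring,
      show a + (γ / 2 + β / 2 + 1) = ((d : ℝ) + γ) / 2 + 1 by rw [ha_def]; ring,
      show γ / 2 + β / 2 + 1 = (β + γ) / 2 + 1 by ring,
      show 1 - β / 2 = (2 - β) / 2 by ring, ← Real.rpow_natCast, ← Real.rpow_mul hy0.le,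
      show ((2 : ℕ) : ℝ) * -a = β - d by rw [ha_def]; push_cast; ring]
    field_simp

/-! ### Holomorphy in the parameters and analytic continuation. -/

section ComplexParameters

lemma ofReal_ascPochhammer_eval (n : ℕ) (x : ℝ) :
    (((ascPochhammer ℝ n).eval x : ℝ) : ℂ) = (ascPochhammer ℂ n).eval (x : ℂ) := by
  induction n with
  | zero => simp
  | succ n ih => simp [ascPochhammer_succ_eval, ih]

lemma ofReal_ordinaryHypergeometric (a b c x : ℝ) :
    ((ordinaryHypergeometric a b c x : ℝ) : ℂ) =
      ordinaryHypergeometric (a : ℂ) (b : ℂ) (c : ℂ) (x : ℂ) := by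
  simp only [ordinaryHypergeometric_eq_tsum, Complex.ofReal_tsum, smul_eq_mul]
  simp [ofReal_ascPochhammer_eval]

lemma norm_ascPochhammer_eval_le (n : ℕ) {z : ℂ} {x : ℝ} (h : ‖z‖ ≤ x) :
    ‖(ascPochhammer ℂ n).eval z‖ ≤ (ascPochhammer ℝ n).eval x := by
  have hx : 0 ≤ x := (norm_nonneg z).trans h
  induction n with
  | zero => simp
  | succ n ih =>
    rw [ascPochhammer_succ_eval, ascPochhammer_succ_eval, norm_mul]
    have h1 : ‖z + n‖ ≤ x + n := (norm_add_le _ _).trans (by simpa using h)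
    exact mul_le_mul ih h1 (norm_nonneg _) ((norm_nonneg _).trans ih)

/-- The Gauss hypergeometric function is holomorphic in its upper parameters. -/
lemma differentiableOn_ordinaryHypergeometric {U : Set ℂ} (hU : IsOpen U) {A B : ℂ → ℂ}
    (hA : Differentiable ℂ A) (hB : Differentiable ℂ B) {M c x : ℝ}
    (hAM : ∀ z ∈ U, ‖A z‖ ≤ M) (hBM : ∀ z ∈ U, ‖B z‖ ≤ M) (hc : 0 < c) (hx0 : 0 ≤ x)
    (hx1 : x < 1) :
    DifferentiableOn ℂ (fun z => ordinaryHypergeometric (A z) (B z) (c : ℂ) (x : ℂ)) U := by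
  -- The majorant is the series with both upper parameters `M'`; positivity of `M'` makes its radius
  -- exactly `1`.
  set M' : ℝ := max M 1
  have hM' : 0 < M' := lt_of_lt_of_le one_pos (le_max_right _ _)
  have hpos : ∀ (n : ℕ) {t : ℝ}, 0 < t → 0 < (ascPochhammer ℝ n).eval t :=
    fun n t ht => ascPochhammer_pos n t ht
  have hne : ∀ (k : ℕ) {t : ℝ}, 0 < t → (k : ℝ) ≠ -t := fun k t ht => by
    have : (0 : ℝ) ≤ k := k.cast_nonneg
    linarith
  have hrad : (ordinaryHypergeometricSeries ℝ M' M' c).radius = 1 :=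
    ordinaryHypergeometricSeries_radius_eq_one _ _ _ _ fun k => ⟨hne k hM', hne k hM', hne k hc⟩
  have hsum : Summable fun n => (n ! : ℝ)⁻¹ * (ascPochhammer ℝ n).eval M' *
      (ascPochhammer ℝ n).eval M' * ((ascPochhammer ℝ n).eval c)⁻¹ * x ^ n := by
    have h1 := (ordinaryHypergeometricSeries ℝ M' M' c).summable (x := x) (by
      rw [hrad]
      simp only [Metric.mem_eball, edist_zero_right]
      rw [← ofReal_norm, Real.norm_of_nonneg hx0]
      exact ENNReal.ofReal_lt_one.mpr hx1)
    simpa only [ordinaryHypergeometricSeries_apply_eq, smul_eq_mul] using h1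
  simp only [ordinaryHypergeometric_eq_tsum, smul_eq_mul]
  refine Complex.differentiableOn_tsum_of_summable_norm hsum (fun n => ?_) hU fun n z hz => ?_
  · have h1 : ∀ {F : ℂ → ℂ}, Differentiable ℂ F →
        Differentiable ℂ fun z => (ascPochhammer ℂ n).eval (F z) := fun hF =>
      (Polynomial.differentiable (ascPochhammer ℂ n)).comp hF
    have h2 := h1 hA
    have h3 := h1 hB
    exact (by fun_prop : Differentiable ℂ fun z => ((n ! : ℂ)⁻¹ * (ascPochhammer ℂ n).eval (A z) *
      (ascPochhammer ℂ n).eval (B z) * ((ascPochhammer ℂ n).eval (c : ℂ))⁻¹) *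
        (x : ℂ) ^ n).differentiableOn
  · rw [← ofReal_ascPochhammer_eval, norm_mul, norm_mul, norm_mul, norm_mul, norm_inv, norm_inv,
      norm_pow, Complex.norm_real, Complex.norm_real, Real.norm_of_nonneg hx0,
      Real.norm_of_nonneg (hpos n hc).le, Complex.norm_natCast]
    have := hpos n hc
    have := hpos n hM'
    gcongr
    · exact norm_ascPochhammer_eval_le n ((hAM z hz).trans (le_max_left _ _))
    · exact norm_ascPochhammer_eval_le n ((hBM z hz).trans (le_max_left _ _))

lemma eq_of_eqOn_Ioo_of_differentiableOn {U : Set ℂ} (hU : IsOpen U) (hUc : Convex ℝ U)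
    {F G : ℂ → ℂ} (hF : DifferentiableOn ℂ F U) (hG : DifferentiableOn ℂ G U) {b₁ b₂ : ℝ}
    (hb : b₁ < b₂) (hbU : ∀ x ∈ Ioo b₁ b₂, (x : ℂ) ∈ U)
    (h : ∀ x ∈ Ioo b₁ b₂, F (x : ℝ) = G (x : ℝ)) : EqOn F G U := by
  obtain ⟨x₀, hx₀⟩ := nonempty_Ioo.mpr hb
  refine (hF.analyticOnNhd hU).eqOn_of_preconnected_of_frequently_eq (hG.analyticOnNhd hU)
    hUc.isPreconnected (hbU x₀ hx₀) ?_
  have h_real : ∃ᶠ x : ℝ in 𝓝[≠] x₀, F x = G x := by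
    refine Eventually.frequently ?_
    filter_upwards [nhdsWithin_le_nhds (Ioo_mem_nhds hx₀.1 hx₀.2)] with s hs using h s hs
  have ht : Tendsto (fun x : ℝ => (x : ℂ)) (𝓝[≠] x₀) (𝓝[≠] (x₀ : ℂ)) := by
    refine tendsto_nhdsWithin_iff.mpr ⟨?_, ?_⟩
    · exact (Complex.continuous_ofReal.tendsto x₀).mono_left nhdsWithin_le_nhds
    · filter_upwards [self_mem_nhdsWithin] with x hx
      simpa using hx
  exact ht.frequently h_real

end ComplexParameters

/-! ### Dimension one, including `1 < β < 2`. -/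

section OneDimensional

/-- The sum of the values of `(1 - x²)_+^(γ/2)` at the two points at distance `r` from `ρ`. -/
noncomputable def pairProfile (γ ρ r : ℝ) : ℝ :=
  max (1 - (ρ + r) ^ 2) 0 ^ (γ / 2) + max (1 - (ρ - r) ^ 2) 0 ^ (γ / 2)

lemma max_one_sub_sq_rpow_le_one {p : ℝ} (hp : 0 < p) (x : ℝ) : max (1 - x ^ 2) 0 ^ p ≤ 1 :=
  Real.rpow_le_one (le_max_right _ _) (max_le (by linarith [sq_nonneg x]) zero_le_one) hp.le

lemma max_one_sub_sq_rpow_eq_zero {p : ℝ} (hp : 0 < p) {x : ℝ} (hx : 1 ≤ |x|) :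
    max (1 - x ^ 2) 0 ^ p = 0 := by
  rw [max_eq_right, Real.zero_rpow hp.ne']
  have := (one_le_sq_iff_one_le_abs x).mpr hx
  linarith

lemma continuous_max_one_sub_sq_rpow {p : ℝ} (hp : 0 < p) :
    Continuous fun x : ℝ => max (1 - x ^ 2) 0 ^ p :=
  (by fun_prop : Continuous fun x : ℝ => max (1 - x ^ 2) 0).rpow_const fun _ => Or.inr hp.le

lemma continuous_pairProfile {γ : ℝ} (hγ : 0 < γ) :
    Continuous fun q : ℝ × ℝ => pairProfile γ q.1 q.2 := by
  have h := continuous_max_one_sub_sq_rpow (p := γ / 2) (by positivity)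
  exact (h.comp (continuous_fst.add continuous_snd)).add
    (h.comp (continuous_fst.sub continuous_snd))

lemma pairProfile_nonneg (γ ρ r : ℝ) : 0 ≤ pairProfile γ ρ r := by
  unfold pairProfile
  positivity

lemma pairProfile_le_two {γ : ℝ} (hγ : 0 < γ) (ρ r : ℝ) : pairProfile γ ρ r ≤ 2 := by
  have h1 := max_one_sub_sq_rpow_le_one (p := γ / 2) (by positivity) (ρ + r)
  have h2 := max_one_sub_sq_rpow_le_one (p := γ / 2) (by positivity) (ρ - r)
  unfold pairProfile
  linarith

lemma pairProfile_eq_zero {γ : ℝ} (hγ : 0 < γ) {ρ r : ℝ} (hr : |ρ| + 1 ≤ r) :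
    pairProfile γ ρ r = 0 := by
  have h1 := neg_abs_le ρ
  have h2 := le_abs_self ρ
  rw [pairProfile, max_one_sub_sq_rpow_eq_zero (by positivity)
    (le_trans (by linarith) (le_abs_self (ρ + r))), max_one_sub_sq_rpow_eq_zero (by positivity)
    (le_trans (by linarith) (neg_le_abs (ρ - r))), add_zero]

lemma pairProfile_abs (γ ρ r : ℝ) : pairProfile γ |ρ| r = pairProfile γ ρ r := by
  rcases abs_choice ρ with h | h
  · rw [h]
  · rw [h, pairProfile, pairProfile, add_comm]
    congr 4 <;> ring

lemma integrableOn_indicator_rpow {β : ℝ} (hβ : 0 < β) (R C : ℝ) :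
    IntegrableOn (fun r : ℝ => (Iio R).indicator (fun r => C * r ^ (β - 1)) r) (Ioi 0) := by
  rw [integrableOn_indicator_iff measurableSet_Iio]
  rcases le_or_gt R 0 with hR | hR
  · have : Iio R ∩ Ioi 0 = ∅ := by
      ext x
      simp only [mem_inter_iff, mem_Iio, mem_Ioi, mem_empty_iff_false, iff_false]
      rintro ⟨h1, h2⟩
      linarith
    rw [this]
    exact integrableOn_empty
  · have h := (intervalIntegral.intervalIntegrable_rpow' (a := 0) (b := R)
      (show -1 < β - 1 by linarith)).const_mul C
    rw [intervalIntegrable_iff_integrableOn_Ioo_of_le hR.le] at h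
    rwa [Iio_inter_Ioi]

lemma norm_rpow_mul_le_indicator {β R C r b : ℝ} (hr : 0 < r) (hb : |b| ≤ C)
    (hzero : R ≤ r → b = 0) :
    ‖r ^ (β - 1) * b‖ ≤ (Iio R).indicator (fun r => C * r ^ (β - 1)) r := by
  by_cases h : r ∈ Iio R
  · rw [indicator_of_mem h, norm_mul, Real.norm_of_nonneg (Real.rpow_nonneg hr.le _), mul_comm,
      Real.norm_eq_abs]
    exact mul_le_mul_of_nonneg_right hb (Real.rpow_nonneg hr.le _)
  · rw [indicator_of_notMem h, hzero (not_lt.mp h), mul_zero, norm_zero]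

lemma norm_rpow_mul_pairProfile_le {γ : ℝ} (hγ : 0 < γ) {β ρ r R : ℝ} (hr : 0 < r)
    (hR : |ρ| + 1 ≤ R) :
    ‖r ^ (β - 1) * pairProfile γ ρ r‖ ≤ (Iio R).indicator (fun r => 2 * r ^ (β - 1)) r :=
  norm_rpow_mul_le_indicator hr
    (by rw [abs_of_nonneg (pairProfile_nonneg γ ρ r)]; exact pairProfile_le_two hγ ρ r)
    fun h => pairProfile_eq_zero hγ (hR.trans h)

/-- Dominated convergence; this carries the formulas from `ρ ≠ 1` to `ρ = 1`. -/
lemma continuous_integral_rpow_mul_pairProfile {β γ : ℝ} (hβ : 0 < β) (hγ : 0 < γ) :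
    Continuous fun ρ => ∫ r in Ioi (0 : ℝ), r ^ (β - 1) * pairProfile γ ρ r := by
  have hc := continuous_pairProfile hγ
  rw [continuous_iff_continuousAt]
  intro ρ₀
  refine continuousAt_of_dominated (Eventually.of_forall fun ρ => ?_) ?_
    -- For `|ρ - ρ₀| < 1` the support bound `|ρ| + 1` stays below `|ρ₀| + 2`.
    (integrableOn_indicator_rpow hβ (|ρ₀| + 2) 2) ?_
  · exact ((measurable_id.pow_const _).mul
      (hc.comp (Continuous.prodMk_right ρ)).measurable).aestronglyMeasurable
  · filter_upwards [Metric.ball_mem_nhds ρ₀ one_pos] with ρ hρ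
    filter_upwards [ae_restrict_mem measurableSet_Ioi] with r hr
    refine norm_rpow_mul_pairProfile_le hγ hr ?_
    have h1 : |ρ - ρ₀| < 1 := by simpa [Real.dist_eq] using hρ
    have h2 := abs_add_le (ρ - ρ₀) ρ₀
    rw [sub_add_cancel] at h2
    linarith
  · exact ae_of_all _ fun r =>
      (continuous_const.mul (hc.comp (Continuous.prodMk_left r))).continuousAt

lemma mellin_pairProfile (γ ρ β : ℝ) :
    mellin (fun r => (pairProfile γ ρ r : ℂ)) (β : ℂ) =
      ((∫ r in Ioi (0 : ℝ), r ^ (β - 1) * pairProfile γ ρ r : ℝ) : ℂ) := by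
  rw [mellin, ← integral_complex_ofReal]
  refine setIntegral_congr_fun measurableSet_Ioi fun r hr => ?_
  have : (0 : ℝ) ≤ r := le_of_lt hr
  simp only [smul_eq_mul]
  rw [Complex.ofReal_mul, Complex.ofReal_cpow this]
  push_cast
  rfl

lemma differentiableAt_mellin_pairProfile {γ : ℝ} (hγ : 0 < γ) (ρ : ℝ) {z : ℂ} (hz : 0 < z.re) :
    DifferentiableAt ℂ (mellin fun r => (pairProfile γ ρ r : ℂ)) z := by
  have hc : Continuous fun r => (pairProfile γ ρ r : ℂ) :=
    Complex.continuous_ofReal.comp ((continuous_pairProfile hγ).comp (Continuous.prodMk_right ρ))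
  -- Boundedness near `0` gives `b = 0`; the function vanishes for large `r`, so any decay exponent
  -- above `z.re` serves.
  refine mellin_differentiableAt_of_isBigO_rpow (a := z.re + 1) (b := 0)
    (hc.locallyIntegrable.locallyIntegrableOn _) ?_ (by linarith) ?_ hz
  · refine Asymptotics.IsBigO.of_bound 1 ?_
    filter_upwards [eventually_ge_atTop (|ρ| + 1)] with r hr
    rw [pairProfile_eq_zero hγ hr]
    simp
  · refine Asymptotics.IsBigO.of_bound 2 (Eventually.of_forall fun r => ?_)
    rw [Complex.norm_real, Real.norm_of_nonneg (pairProfile_nonneg γ ρ r)]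
    simpa using pairProfile_le_two hγ ρ r

lemma integrable_and_integral_of_Ioi {f : ℝ → ℝ} (h1 : IntegrableOn f (Ioi 0))
    (h2 : IntegrableOn (fun x => f (-x)) (Ioi 0)) :
    Integrable f ∧ ∫ x, f x = ∫ x in Ioi 0, (f x + f (-x)) := by
  have h3 : IntegrableOn f (Iic 0) := by
    rw [integrableOn_Iic_iff_integrableOn_Iio]
    have := ((Measure.measurePreserving_neg (volume : Measure ℝ)).integrableOn_comp_preimage
      (MeasurableEquiv.neg ℝ).measurableEmbedding (f := f) (s := Iio 0)).mp
    refine this ?_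
    have hs : Neg.neg ⁻¹' Iio (0 : ℝ) = Ioi 0 := by ext; simp
    rw [hs]
    exact h2
  refine ⟨?_, ?_⟩
  · rw [← integrableOn_univ, ← Iic_union_Ioi (a := (0 : ℝ))]
    exact h3.union h1
  · rw [integral_add h1 h2, integral_comp_neg_Ioi, neg_zero, add_comm,
      intervalIntegral.integral_Iic_add_Ioi h3 h1]

/-- Folding the line at the origin turns the integral into a Mellin transform, in which `β` may
become complex. -/
lemma integral_rieszIntegrand_ballProfile_one {β γ : ℝ} (hβ : 0 < β) (hγ : 0 < γ)
    (y : EuclideanSpace ℝ (Fin 1)) :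
    Integrable (rieszIntegrand β (ballProfile γ) y) ∧
      ∫ z, rieszIntegrand β (ballProfile γ) y z =
        ∫ r in Ioi (0 : ℝ), r ^ (β - 1) * pairProfile γ ‖y‖ r := by
  set e : ℝ ≃ₗᵢ[ℝ] EuclideanSpace ℝ (Fin 1) := (OrthonormalBasis.singleton (Fin 1) ℝ).repr
  obtain ⟨η, rfl⟩ := e.surjective y
  set f : ℝ → ℝ := fun x => max (1 - (η + x) ^ 2) 0 ^ (γ / 2) * |x| ^ (β - 1) with hf
  have hfe : ∀ x, rieszIntegrand β (ballProfile γ) (e η) (e x) = f x := by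
    intro x
    rw [rieszIntegrand, ballProfile, ← map_add, e.norm_map, e.norm_map, Real.norm_eq_abs,
      Real.norm_eq_abs, sq_abs, div_eq_mul_inv, ← Real.rpow_neg (abs_nonneg x), hf]
    simp
  have hbound : ∀ σ : ℝ, |σ| = 1 → IntegrableOn (fun x => f (σ * x)) (Ioi 0) := by
    intro σ hσ
    refine Integrable.mono' (integrableOn_indicator_rpow hβ (|η| + 1) 1) ?_ ?_
    · exact (by fun_prop : Measurable fun x => f (σ * x)).aestronglyMeasurable
    · filter_upwards [ae_restrict_mem measurableSet_Ioi] with r hr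
      have hr0 : (0 : ℝ) < r := hr
      simp only [hf]
      rw [abs_mul, hσ, one_mul, abs_of_pos hr0, mul_comm]
      refine norm_rpow_mul_le_indicator hr0 ?_ fun hR => ?_
      · rw [abs_of_nonneg (by positivity)]
        exact max_one_sub_sq_rpow_le_one (by positivity) _
      · refine max_one_sub_sq_rpow_eq_zero (by positivity) ?_
        have h1 := abs_sub_abs_le_abs_add (σ * r) η
        rw [abs_mul, hσ, one_mul, abs_of_pos hr0, add_comm (σ * r)] at h1
        linarith
  obtain ⟨hi, hI⟩ := integrable_and_integral_of_Ioi (f := f) (by simpa using hbound 1 (by simp))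
    (by simpa using hbound (-1) (by simp))
  have hmp := e.measurePreserving
  have hme := e.toHomeomorph.measurableEmbedding
  have hcomp : rieszIntegrand β (ballProfile γ) (e η) ∘ e = f := funext hfe
  constructor
  · refine (hmp.integrable_comp_emb hme).mp ?_
    rw [hcomp]
    exact hi
  · rw [← hmp.integral_comp hme, integral_congr_ae (ae_of_all _ hfe), hI, e.norm_map,
      Real.norm_eq_abs]
    refine setIntegral_congr_fun measurableSet_Ioi fun r hr => ?_
    have hr0 : (0 : ℝ) < r := hr
    simp only [hf]
    rw [pairProfile_abs, pairProfile, abs_neg, abs_of_pos hr0, ← sub_eq_add_neg]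
    ring

/-- The half-disc contains the interval `(0, 2)`, is connected, and is bounded, which gives the
uniform parameter bounds needed for the hypergeometric majorant. -/
lemma convex_re_pos_inter_ball : Convex ℝ ({z : ℂ | 0 < z.re} ∩ Metric.ball 0 2) :=
  ((convex_Ioi (0 : ℝ)).linear_preimage Complex.reLm).inter (convex_ball _ _)

lemma isOpen_re_pos_inter_ball : IsOpen ({z : ℂ | 0 < z.re} ∩ Metric.ball 0 2) :=
  (isOpen_lt continuous_const Complex.continuous_re).inter Metric.isOpen_ball

lemma ofReal_mem_re_pos_inter_ball {β : ℝ} (hβ : 0 < β) (hβ2 : β < 2) :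
    (β : ℂ) ∈ {z : ℂ | 0 < z.re} ∩ Metric.ball 0 2 := by
  refine ⟨by simpa using hβ, ?_⟩
  rw [mem_ball_zero_iff, Complex.norm_real, Real.norm_of_nonneg hβ.le]
  exact hβ2

lemma exists_norm_eq_fin_one {ρ : ℝ} (hρ : 0 ≤ ρ) : ∃ y : EuclideanSpace ℝ (Fin 1), ‖y‖ = ρ :=
  ⟨(OrthonormalBasis.singleton (Fin 1) ℝ).repr ρ,
    (LinearIsometryEquiv.norm_map _ ρ).trans (Real.norm_of_nonneg hρ)⟩

/-- Analytic continuation in `β` from `(0, 1)`, where the case `β < d` applies with `d = 1`.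
Strictness of `ρ < 1` keeps the series inside its disc of convergence. -/
lemma integral_rpow_mul_pairProfile_of_lt_one {β γ ρ : ℝ} (hβ : 0 < β) (hβ2 : β < 2) (hγ : 0 < γ)
    (hρ : 0 ≤ ρ) (hρ1 : ρ < 1) :
    ∫ r in Ioi (0 : ℝ), r ^ (β - 1) * pairProfile γ ρ r =
      Real.pi ^ (1 / 2 : ℝ) * Real.Gamma (γ / 2 + 1) / Real.Gamma (1 / 2) *
        Real.Gamma (β / 2) * (Real.Gamma ((β + γ) / 2 + 1))⁻¹ *
        ordinaryHypergeometric ((1 - β) / 2) (-((γ + β) / 2)) (1 / 2) (ρ ^ 2) := by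
  set K : ℝ := Real.pi ^ (1 / 2 : ℝ) * Real.Gamma (γ / 2 + 1) / Real.Gamma (1 / 2)
  set U : Set ℂ := {z : ℂ | 0 < z.re} ∩ Metric.ball 0 2
  set G : ℂ → ℂ := fun z => K * Complex.Gamma (z / 2) * (Complex.Gamma ((z + γ) / 2 + 1))⁻¹ *
    ordinaryHypergeometric ((1 - z) / 2) (-((γ + z) / 2)) ((1 / 2 : ℝ) : ℂ) ((ρ ^ 2 : ℝ) : ℂ)
    with hG
  have hGreal : ∀ x : ℝ, G x = ((K * Real.Gamma (x / 2) * (Real.Gamma ((x + γ) / 2 + 1))⁻¹ *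
      ordinaryHypergeometric ((1 - x) / 2) (-((γ + x) / 2)) (1 / 2) (ρ ^ 2) : ℝ) : ℂ) := by
    intro x
    rw [Complex.ofReal_mul, ofReal_ordinaryHypergeometric, Complex.ofReal_mul, Complex.ofReal_mul,
      Complex.ofReal_inv, ← Complex.Gamma_ofReal, ← Complex.Gamma_ofReal, hG]
    push_cast
    rfl
  have hUn : ∀ z ∈ U, ‖z‖ ≤ 2 := fun z hz => (mem_ball_zero_iff.mp hz.2).le
  have hGd : DifferentiableOn ℂ G U := by
    refine DifferentiableOn.mul (DifferentiableOn.mul (DifferentiableOn.mul ?_ ?_) ?_) ?_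
    · exact differentiableOn_const _
    · intro z hz
      have : DifferentiableAt ℂ Complex.Gamma (z / 2) := by
        refine Complex.differentiableAt_Gamma _ fun m hm => ?_
        have h1 := congrArg Complex.re hm
        have h2 : 0 < z.re := hz.1
        have h3 : (0 : ℝ) ≤ m := m.cast_nonneg
        simp at h1
        linarith
      exact (DifferentiableAt.comp z this (by fun_prop)).differentiableWithinAt
    · exact (Complex.differentiable_one_div_Gamma.comp
        (by fun_prop : Differentiable ℂ fun z : ℂ => (z + γ) / 2 + 1)).differentiableOn
    · refine differentiableOn_ordinaryHypergeometric (M := 2 + γ) isOpen_re_pos_inter_ball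
        (by fun_prop) (by fun_prop) (fun z hz => ?_) (fun z hz => ?_) (by norm_num) (by positivity)
        (pow_lt_one₀ hρ hρ1 two_ne_zero)
      · rw [norm_div, Complex.norm_ofNat]
        have := norm_sub_le 1 z
        have := hUn z hz
        rw [norm_one] at *
        linarith
      · rw [norm_neg, norm_div, Complex.norm_ofNat]
        have := norm_add_le (γ : ℂ) z
        have := hUn z hz
        rw [Complex.norm_real, Real.norm_of_nonneg hγ.le] at *
        linarith
  have hEq : EqOn (mellin fun r => (pairProfile γ ρ r : ℂ)) G U := by
    refine eq_of_eqOn_Ioo_of_differentiableOn isOpen_re_pos_inter_ball convex_re_pos_inter_ball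
      (fun z hz => (differentiableAt_mellin_pairProfile hγ ρ hz.1).differentiableWithinAt) hGd
      (zero_lt_one' ℝ) (fun x hx => ofReal_mem_re_pos_inter_ball hx.1 (by linarith [hx.2]))
      fun x hx => ?_
    obtain ⟨y, hy⟩ := exists_norm_eq_fin_one hρ
    rw [mellin_pairProfile, hGreal, ← hy,
      ← (integral_rieszIntegrand_ballProfile_one hx.1 hγ y).2,
      (integral_rieszIntegrand_ballProfile_of_lt le_rfl hx.1 (by simpa using hx.2) hγ y).2.1
        (by rw [hy]; exact hρ1.le), Nat.cast_one]
  have h := hEq (ofReal_mem_re_pos_inter_ball hβ hβ2)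
  rw [mellin_pairProfile, hGreal] at h
  exact_mod_cast h

lemma integral_rpow_mul_pairProfile_of_one_lt {β γ ρ : ℝ} (hβ : 0 < β) (hβ2 : β < 2) (hγ : 0 < γ)
    (hρ1 : 1 < ρ) :
    ∫ r in Ioi (0 : ℝ), r ^ (β - 1) * pairProfile γ ρ r =
      Real.pi ^ (1 / 2 : ℝ) * Real.Gamma (γ / 2 + 1) / Real.Gamma ((1 + γ) / 2 + 1) *
        ρ ^ (β - 1) *
        ordinaryHypergeometric ((1 - β) / 2) ((2 - β) / 2) ((1 + γ) / 2 + 1) (1 / ρ ^ 2) := by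
  have hρ : 0 < ρ := by linarith
  set K : ℝ := Real.pi ^ (1 / 2 : ℝ) * Real.Gamma (γ / 2 + 1) / Real.Gamma ((1 + γ) / 2 + 1)
  set U : Set ℂ := {z : ℂ | 0 < z.re} ∩ Metric.ball 0 2
  set G : ℂ → ℂ := fun z => K * (ρ : ℂ) ^ (z - 1) *
    ordinaryHypergeometric ((1 - z) / 2) ((2 - z) / 2) (((1 + γ) / 2 + 1 : ℝ) : ℂ)
      ((1 / ρ ^ 2 : ℝ) : ℂ) with hG
  have hGreal : ∀ x : ℝ, G x = ((K * ρ ^ (x - 1) *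
      ordinaryHypergeometric ((1 - x) / 2) ((2 - x) / 2) ((1 + γ) / 2 + 1) (1 / ρ ^ 2) : ℝ) :
        ℂ) := by
    intro x
    rw [Complex.ofReal_mul, ofReal_ordinaryHypergeometric, Complex.ofReal_mul,
      Complex.ofReal_cpow hρ.le, hG]
    push_cast
    rfl
  have hUn : ∀ z ∈ U, ‖z‖ ≤ 2 := fun z hz => (mem_ball_zero_iff.mp hz.2).le
  have hGd : DifferentiableOn ℂ G U := by
    refine DifferentiableOn.mul (DifferentiableOn.mul ?_ ?_) ?_
    · exact differentiableOn_const _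
    · refine Differentiable.differentiableOn ?_
      exact Differentiable.const_cpow (by fun_prop) (Or.inl (by exact_mod_cast hρ.ne'))
    · refine differentiableOn_ordinaryHypergeometric (M := 2) isOpen_re_pos_inter_ball
        (by fun_prop) (by fun_prop) (fun z hz => ?_) (fun z hz => ?_) (by positivity)
        (by positivity) ((div_lt_one (by positivity)).mpr (one_lt_pow₀ hρ1 two_ne_zero))
      · rw [norm_div, Complex.norm_ofNat]
        have := norm_sub_le 1 z
        have := hUn z hz
        rw [norm_one] at *
        linarith
      · rw [norm_div, Complex.norm_ofNat]
        have := norm_sub_le 2 z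
        have := hUn z hz
        rw [Complex.norm_ofNat] at *
        linarith
  have hEq : EqOn (mellin fun r => (pairProfile γ ρ r : ℂ)) G U := by
    refine eq_of_eqOn_Ioo_of_differentiableOn isOpen_re_pos_inter_ball convex_re_pos_inter_ball
      (fun z hz => (differentiableAt_mellin_pairProfile hγ ρ hz.1).differentiableWithinAt) hGd
      (zero_lt_one' ℝ) (fun x hx => ofReal_mem_re_pos_inter_ball hx.1 (by linarith [hx.2]))
      fun x hx => ?_
    obtain ⟨y, hy⟩ := exists_norm_eq_fin_one hρ.le
    rw [mellin_pairProfile, hGreal, ← hy,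
      ← (integral_rieszIntegrand_ballProfile_one hx.1 hγ y).2,
      (integral_rieszIntegrand_ballProfile_of_lt le_rfl hx.1 (by simpa using hx.2) hγ y).2.2
        (by rw [hy]; exact hρ1.le), Nat.cast_one]
  have h := hEq (ofReal_mem_re_pos_inter_ball hβ hβ2)
  rw [mellin_pairProfile, hGreal] at h
  exact_mod_cast h

lemma integral_rpow_mul_pairProfile_of_le_one {β γ ρ : ℝ} (hβ : 0 < β) (hβ2 : β < 2) (hγ : 0 < γ)
    (hρ : 0 ≤ ρ) (hρ1 : ρ ≤ 1) :
    ∫ r in Ioi (0 : ℝ), r ^ (β - 1) * pairProfile γ ρ r =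
      Real.pi ^ (1 / 2 : ℝ) * Real.Gamma (γ / 2 + 1) / Real.Gamma (1 / 2) *
        Real.Gamma (β / 2) * (Real.Gamma ((β + γ) / 2 + 1))⁻¹ *
        ordinaryHypergeometric ((1 - β) / 2) (-((γ + β) / 2)) (1 / 2) (ρ ^ 2) := by
  -- Here `c - a - b = β + γ/2 > 0`, so the series is continuous up to argument `1`; the same gap
  -- occurs in the exterior formula.
  have hF := continuousOn_ordinaryHypergeometric_Icc
    (a := (1 - β) / 2) (b := -((γ + β) / 2)) (c := 1 / 2) (by linarith)
  have hcont : ContinuousOn (fun ρ : ℝ => Real.pi ^ (1 / 2 : ℝ) * Real.Gamma (γ / 2 + 1) /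
      Real.Gamma (1 / 2) * Real.Gamma (β / 2) * (Real.Gamma ((β + γ) / 2 + 1))⁻¹ *
      ordinaryHypergeometric ((1 - β) / 2) (-((γ + β) / 2)) (1 / 2) (ρ ^ 2)) (Icc 0 1) := by
    refine continuousOn_const.mul (hF.comp (by fun_prop) fun x hx => ?_)
    exact ⟨sq_nonneg x, pow_le_one₀ hx.1 hx.2⟩
  exact EqOn.of_subset_closure (s := Ico 0 1)
    (fun x hx => integral_rpow_mul_pairProfile_of_lt_one hβ hβ2 hγ hx.1 hx.2)
    (continuous_integral_rpow_mul_pairProfile hβ hγ).continuousOn hcont Ico_subset_Icc_self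
    (by rw [closure_Ico zero_ne_one]) ⟨hρ, hρ1⟩

lemma integral_rpow_mul_pairProfile_of_one_le {β γ ρ : ℝ} (hβ : 0 < β) (hβ2 : β < 2) (hγ : 0 < γ)
    (hρ1 : 1 ≤ ρ) :
    ∫ r in Ioi (0 : ℝ), r ^ (β - 1) * pairProfile γ ρ r =
      Real.pi ^ (1 / 2 : ℝ) * Real.Gamma (γ / 2 + 1) / Real.Gamma ((1 + γ) / 2 + 1) *
        ρ ^ (β - 1) *
        ordinaryHypergeometric ((1 - β) / 2) ((2 - β) / 2) ((1 + γ) / 2 + 1) (1 / ρ ^ 2) := by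
  have hF := continuousOn_ordinaryHypergeometric_Icc
    (a := (1 - β) / 2) (b := (2 - β) / 2) (c := (1 + γ) / 2 + 1) (by linarith)
  have hpos : ∀ x ∈ Ici (1 : ℝ), 0 < x := fun x hx => lt_of_lt_of_le one_pos hx
  have hcont : ContinuousOn (fun ρ : ℝ => Real.pi ^ (1 / 2 : ℝ) * Real.Gamma (γ / 2 + 1) /
      Real.Gamma ((1 + γ) / 2 + 1) * ρ ^ (β - 1) *
      ordinaryHypergeometric ((1 - β) / 2) ((2 - β) / 2) ((1 + γ) / 2 + 1) (1 / ρ ^ 2))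
      (Ici 1) := by
    refine (continuousOn_const.mul (continuousOn_id.rpow_const fun x hx =>
      Or.inl (hpos x hx).ne')).mul (hF.comp (continuousOn_const.div (by fun_prop) fun x hx =>
        (pow_pos (hpos x hx) 2).ne') fun x hx => ?_)
    have := hpos x hx
    exact ⟨by positivity, (div_le_one (by positivity)).mpr (one_le_pow₀ hx)⟩
  exact EqOn.of_subset_closure (s := Ioi 1)
    (fun x hx => integral_rpow_mul_pairProfile_of_one_lt hβ hβ2 hγ hx)
    (continuous_integral_rpow_mul_pairProfile hβ hγ).continuousOn hcont Ioi_subset_Ici_self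
    (by rw [closure_Ioi]) hρ1

end OneDimensional

/-! ### Assembly of the two cases and the constants. -/

/-- The potential of the ball profile, without its normalising constant. -/
lemma integral_rieszIntegrand_ballProfile {d : ℕ} (hd : 1 ≤ d) {β γ : ℝ} (hβ : 0 < β)
    (hβ2 : β < 2) (hβd : β ≠ d) (hγ : 0 < γ) (y : EuclideanSpace ℝ (Fin d)) :
    Integrable (rieszIntegrand β (ballProfile γ) y) ∧
    (‖y‖ ≤ 1 → ∫ z, rieszIntegrand β (ballProfile γ) y z =
      Real.pi ^ ((d : ℝ) / 2) * Real.Gamma (γ / 2 + 1) / Real.Gamma ((d : ℝ) / 2) *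
        Real.Gamma (β / 2) * (Real.Gamma ((β + γ) / 2 + 1))⁻¹ *
        ordinaryHypergeometric (((d : ℝ) - β) / 2) (-((γ + β) / 2)) ((d : ℝ) / 2) (‖y‖ ^ 2)) ∧
    (1 ≤ ‖y‖ → ∫ z, rieszIntegrand β (ballProfile γ) y z =
      Real.pi ^ ((d : ℝ) / 2) * Real.Gamma (γ / 2 + 1) / Real.Gamma (((d : ℝ) + γ) / 2 + 1) *
        ‖y‖ ^ (β - (d : ℝ)) *
        ordinaryHypergeometric (((d : ℝ) - β) / 2) ((2 - β) / 2) (((d : ℝ) + γ) / 2 + 1)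
          (1 / ‖y‖ ^ 2)) := by
  rcases lt_or_gt_of_ne hβd with h | h
  · exact integral_rieszIntegrand_ballProfile_of_lt hd hβ h hγ y
  · have hd1 : d = 1 := by
      have : (d : ℝ) < (2 : ℕ) := by push_cast; linarith
      have := Nat.cast_lt.mp this
      omega
    subst hd1
    obtain ⟨hi, hI⟩ := integral_rieszIntegrand_ballProfile_one hβ hγ y
    rw [hI, Nat.cast_one]
    exact ⟨hi, integral_rpow_mul_pairProfile_of_le_one hβ hβ2 hγ (norm_nonneg y),
      integral_rpow_mul_pairProfile_of_one_le hβ hβ2 hγ⟩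

theorem lemma2 (d : ℕ) (hd : 1 ≤ d) (β γ : ℝ) (hβ : 0 < β) (hβ2 : β < 2) (hβd : β ≠ (d : ℝ))
    (hγ : 0 < γ) (y : EuclideanSpace ℝ (Fin d)) :
    Integrable (rieszIntegrand β (ballProfile γ) y) ∧
    (‖y‖ ≤ 1 →
      rieszPotential β (ballProfile γ) y =
        innerConstant d γ β *
          ordinaryHypergeometric (((d : ℝ) - β) / 2) (-((γ + β) / 2)) ((d : ℝ) / 2) (‖y‖ ^ 2)) ∧
    (1 ≤ ‖y‖ →
      rieszPotential β (ballProfile γ) y =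
        outerConstant d γ β * ‖y‖ ^ (β - (d : ℝ)) *
          ordinaryHypergeometric (((d : ℝ) - β) / 2) ((2 - β) / 2) (((d : ℝ) + γ) / 2 + 1)
            (1 / ‖y‖ ^ 2)) := by
  obtain ⟨hint, hin, hout⟩ := integral_rieszIntegrand_ballProfile hd hβ hβ2 hβd hγ y
  have hpi : Real.pi ^ ((d : ℝ) / 2) ≠ 0 := (Real.rpow_pos_of_pos Real.pi_pos _).ne'
  have hΓ : Real.Gamma (β / 2) ≠ 0 := (Real.Gamma_pos_of_pos (by positivity)).ne'
  refine ⟨hint, fun hy => ?_, fun hy => ?_⟩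
  · rw [rieszPotential, hin hy, rieszConstant, innerConstant, Real.rpow_neg zero_le_two]
    field_simp
  · rw [rieszPotential, hout hy, rieszConstant, outerConstant, Real.rpow_neg zero_le_two]
    field_simp
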